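/- For a finite group $G$ with identity $e$ and positive integers $k,\ell$, a $(k,\ell)$-near-factorization of $G$ is a pair $(A,B)$ of subsets of $G$ with $|A|=k$, $|B|=\ell$, $|A|\cdot|B|=|G|-1$ and $AB=\{gh : g\in A,\ h\in B\}=G\setminus\{e\}$. Two near-factorizations $(A,B)$ and $(A',B')$ of $G$ are equivalent if $A'=f(A)h$ and $B'=h^{-1}f(B)$ for some automorphism $f$ of $G$ and some $h\in G$. Let $D_n=\langle a,b : a^2=b^n=abab=e\rangle$ be the dihedral group of order $2n$. Theorem. For every integer $n$ with $1\le n\le 32$ and every proper divisor $k$ of $2n-1$ (that is, every positive divisor $k<2n-1$), there is exactly one $\bigl(k,(2n-1)/k\bigr)$-near-factorization of $D_n$ up to equivalence; that is, one exists, and any two are equivalent. -/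

import Mathlib

open scoped Pointwise

/-- `(A, B)` is a `(k, l)`-near-factorization of the finite group `G`: `|A| = k`, `|B| = l`,
`|A| * |B| = |G| - 1` and `A B = G - e`. -/
def IsNearFactorization {G : Type*} [Group G] [Fintype G] [DecidableEq G] (k l : ℕ)
    (A B : Finset G) : Prop :=
  A.card = k ∧ B.card = l ∧ A.card * B.card = Fintype.card G - 1 ∧ A * B = Finset.univ \ {1}

/-- `(A', B')` is equivalent to `(A, B)`: `(A', B') = (f(A) h, h⁻¹ f(B))` for some automorphism
`f` of `G` and some `h` in `G`. -/
def NearFactorizationEquiv {G : Type*} [Group G] [DecidableEq G]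
    (A B A' B' : Finset G) : Prop :=
  ∃ (f : MulAut G) (h : G), A' = A.image f * {h} ∧ B' = {h⁻¹} * B.image f

/-! Write a subset of `G` for the sum of its elements in `ℚ[G]`. A near-factorization then says `A *
B = G - 1`, and since `A * G = |A| G`, the element `|A|⁻¹ G - B` is an inverse of `A`. Hence `A`
determines `B` (`right_unique`), `B * A = G - 1` holds as well (`isNearFactorization_swap`), and
only first factors have to be compared.

Existence is explicit: for `k = 2 * m + 1`, take intervals of `m + 1` rotations and `m` reflections,
with arithmetic progressions of difference `k` in the mate (`subset_intervalFactor_mul`).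

For uniqueness, inversion exchanges the factors, so `k ≤ l` may be assumed; as `2 * n - 1 ≤ 63`,
this leaves `k ≤ 7`, and `k = 1` is trivial. A nontrivial sign character takes values with product
`-1` on the two factors, hence `±1` on each. So up to a swap `A` has `m + 1` rotations and `m`
reflections, and for even `n` both sets are nearly balanced between even and odd exponents.
Automorphisms and right translations move the two sets independently and multiply both by a common
unit, which leaves a list of normal forms. A mate of `A` is an exact cover of two copies of `G - 1`
by the pairs `(A b, b A)`; a finite search shows that no normal form but the interval factor has one
(`factorEquiv_intervalFactor_of_check`).

The search is evaluated by the kernel. A family of tiles is packed into one natural number, so that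
a few bitwise operations treat all lanes at once. Only one direction needs proof: an existing cover
is never missed (`cover_eq_true`). -/

namespace NearFactorization

/-! ### Packed families of natural numbers -/

/-- The family `f 0, …, f (m - 1)` written in base `W`. -/
def packed (W m : ℕ) (f : ℕ → ℕ) : ℕ := ∑ i ∈ Finset.range m, f i * W ^ i

section packed

variable {W m : ℕ} {f g : ℕ → ℕ}

theorem packed_zero : packed W 0 f = 0 := by simp [packed]

theorem packed_succ : packed W (m + 1) f = f 0 + W * packed W m (fun i => f (i + 1)) := by
  simp only [packed, Finset.sum_range_succ', Finset.mul_sum, pow_zero, mul_one, pow_succ]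
  rw [add_comm]
  congr 1
  exact Finset.sum_congr rfl fun i _ => by ring

theorem packed_congr (h : ∀ i < m, f i = g i) : packed W m f = packed W m g :=
  Finset.sum_congr rfl fun i hi => by rw [h i (Finset.mem_range.1 hi)]

theorem packed_add : packed W m f + packed W m g = packed W m fun i => f i + g i := by
  simp [packed, ← Finset.sum_add_distrib, add_mul]

theorem mul_packed (c : ℕ) : c * packed W m f = packed W m fun i => c * f i := by
  simp [packed, Finset.mul_sum, mul_assoc]

theorem packed_lt (h : ∀ i, f i < W) : packed W m f < W ^ m := by
  induction m generalizing f with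
  | zero => simp [packed]
  | succ m ih =>
    rw [packed_succ, pow_succ']
    have h1 := ih (f := fun i => f (i + 1)) fun i => h _
    have h2 := h 0
    calc f 0 + W * packed W m (fun i => f (i + 1)) < W + W * packed W m (fun i => f (i + 1)) := by
          omega
      _ = W * (packed W m (fun i => f (i + 1)) + 1) := by ring
      _ ≤ W * W ^ m := Nat.mul_le_mul_left _ h1

theorem packed_div_mod (hW : 0 < W) (h : ∀ i, f i < W) {q : ℕ} (hq : q < m) :
    packed W m f / W ^ q % W = f q := by
  induction q generalizing f m with
  | zero =>
    obtain ⟨m, rfl⟩ := Nat.exists_eq_succ_of_ne_zero hq.ne'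
    rw [Nat.succ_eq_add_one, packed_succ, pow_zero, Nat.div_one, Nat.add_mul_mod_self_left,
      Nat.mod_eq_of_lt (h 0)]
  | succ q ih =>
    obtain ⟨m, rfl⟩ := Nat.exists_eq_succ_of_ne_zero (Nat.ne_of_gt (Nat.zero_lt_of_lt hq))
    rw [Nat.succ_eq_add_one, packed_succ, pow_succ', ← Nat.div_div_eq_div_mul,
      Nat.add_mul_div_left _ _ hW, Nat.div_eq_of_lt (h 0), zero_add]
    exact ih (fun i => h _) (by omega)

theorem packed_sub_update {q : ℕ} (hq : q < m) :
    packed W m f - f q * W ^ q = packed W m (Function.update f q 0) := by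
  have h1 := Finset.add_sum_erase (Finset.range m) (fun i => f i * W ^ i) (Finset.mem_range.2 hq)
  have h2 := Finset.add_sum_erase (Finset.range m) (fun i => Function.update f q 0 i * W ^ i)
    (Finset.mem_range.2 hq)
  have h3 : ∑ i ∈ (Finset.range m).erase q, Function.update f q 0 i * W ^ i =
      ∑ i ∈ (Finset.range m).erase q, f i * W ^ i :=
    Finset.sum_congr rfl fun i hi => by rw [Function.update_of_ne (Finset.ne_of_mem_erase hi)]
  simp only [Function.update_self, zero_mul, zero_add] at h2
  unfold packed
  omega

theorem testBit_add_two_pow_mul {w a b : ℕ} (ha : a < 2 ^ w) (j : ℕ) :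
    (a + 2 ^ w * b).testBit j = if j < w then a.testBit j else b.testBit (j - w) := by
  rw [add_comm, Nat.testBit_two_pow_mul_add _ ha]

theorem land_add_two_pow_mul {w a b c d : ℕ} (ha : a < 2 ^ w) (hc : c < 2 ^ w) :
    (a + 2 ^ w * b) &&& (c + 2 ^ w * d) = (a &&& c) + 2 ^ w * (b &&& d) := by
  apply Nat.eq_of_testBit_eq
  intro j
  rw [Nat.testBit_land, testBit_add_two_pow_mul ha, testBit_add_two_pow_mul hc,
    testBit_add_two_pow_mul (lt_of_le_of_lt Nat.and_le_left ha)]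
  split_ifs <;> simp

theorem lor_add_two_pow_mul {w a b c d : ℕ} (ha : a < 2 ^ w) (hc : c < 2 ^ w) :
    (a + 2 ^ w * b) ||| (c + 2 ^ w * d) = (a ||| c) + 2 ^ w * (b ||| d) := by
  apply Nat.eq_of_testBit_eq
  intro j
  rw [Nat.testBit_lor, testBit_add_two_pow_mul ha, testBit_add_two_pow_mul hc,
    testBit_add_two_pow_mul (Nat.or_lt_two_pow ha hc)]
  split_ifs <;> simp

theorem packed_land {w : ℕ} (hf : ∀ i, f i < 2 ^ w) (hg : ∀ i, g i < 2 ^ w) :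
    packed (2 ^ w) m f &&& packed (2 ^ w) m g = packed (2 ^ w) m fun i => f i &&& g i := by
  induction m generalizing f g with
  | zero => simp [packed]
  | succ m ih =>
    rw [packed_succ, packed_succ, packed_succ, land_add_two_pow_mul (hf 0) (hg 0),
      ih (fun i => hf _) (fun i => hg _)]

theorem packed_lor {w : ℕ} (hf : ∀ i, f i < 2 ^ w) (hg : ∀ i, g i < 2 ^ w) :
    packed (2 ^ w) m f ||| packed (2 ^ w) m g = packed (2 ^ w) m fun i => f i ||| g i := by
  induction m generalizing f g with
  | zero => simp [packed]
  | succ m ih =>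
    rw [packed_succ, packed_succ, packed_succ, lor_add_two_pow_mul (hf 0) (hg 0),
      ih (fun i => hf _) (fun i => hg _)]

end packed

/-! ### Evaluation -/

/-- `k x`, arranged so that `x * c + x % p` is evaluated first. -/
def forceWith {α : Type} (c p x : ℕ) (k : ℕ → α) : α :=
  Nat.rec (k 0) (fun y _ => k (Nat.div (Nat.succ y) c)) (Nat.add (Nat.mul x c) (Nat.mod x p))

/-- `k x`, arranged so that `x` is evaluated first. The literal that the kernel meets has
well-distributed low bits, which its hash tables rely on. -/
def force {α : Type} (x : ℕ) (k : ℕ → α) : α := forceWith 4294967296 4294967291 x k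

/-- `a` if `x = 0`, and `b` otherwise. -/
def ifZero {α : Type} (x : ℕ) (a b : α) : α := Nat.rec a (fun _ _ => b) x

/-- Since `x % p < c`, division by `c` recovers `x`; the case split on the sum only serves to force
its evaluation. -/
theorem forceWith_eq {α : Type} {c p : ℕ} (hp : 0 < p) (hpc : p ≤ c) (x : ℕ) (k : ℕ → α) :
    forceWith c p x k = k x := by
  have h1 : x % p < c := lt_of_lt_of_le (Nat.mod_lt _ hp) hpc
  have h2 : (x * c + x % p) / c = x := by
    rw [mul_comm, Nat.mul_add_div (by omega), Nat.div_eq_of_lt h1, add_zero]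
  change (Nat.rec _ _ (x * c + x % p) : α) = k x
  generalize x * c + x % p = y at h2
  subst h2
  cases y with
  | zero => exact congrArg k (Nat.zero_div c).symm
  | succ y => rfl

theorem force_eq {α : Type} (x : ℕ) (k : ℕ → α) : force x k = k x :=
  forceWith_eq (by norm_num) (by norm_num) x k

theorem ifZero_eq {α : Type} (x : ℕ) (a b : α) : ifZero x a b = if x = 0 then a else b := by
  cases x <;> simp [ifZero]

/-! ### Operations on packed families -/

/-- For `T` packing `t`, this packs the indicator function of `{i | t i &&& g ≠ 0}`. -/
def clash (H o T g : ℕ) : ℕ :=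
  Nat.div (Nat.land (Nat.add (Nat.land T (Nat.mul g o)) (Nat.mul (Nat.sub H 1) o)) (Nat.mul H o)) H

/-- For `T` packing `t` and `F` packing an indicator function, this packs `t` cleared where the
indicator function is `1`. -/
def prune (H o T F : ℕ) : ℕ := Nat.land T (Nat.mul (Nat.sub H 1) (Nat.sub o F))

/-- The value of the lowest binary digit `1`. -/
def lowBit (F : ℕ) : ℕ := Nat.sub F (Nat.land F (Nat.sub F 1))

/-- Adding `2 ^ h - 1` to a number below `2 ^ h` carries into bit `h` exactly when the number is not
zero. -/
theorem add_sub_one_land_two_pow {h x : ℕ} (hx : x < 2 ^ h) :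
    (x + (2 ^ h - 1)) &&& 2 ^ h = 2 ^ h * if x = 0 then 0 else 1 := by
  have hpos : 0 < 2 ^ h := by positivity
  rw [Nat.and_two_pow]
  rcases Nat.eq_zero_or_pos x with rfl | hx0
  · rw [Nat.testBit_eq_false_of_lt (by omega)]; simp
  · have e : x + (2 ^ h - 1) = 2 ^ h * 1 + (x - 1) := by omega
    rw [e, Nat.testBit_two_pow_mul_add _ (by omega)]
    simp [hx0.ne']

/-- Lanes are one bit wider than their contents. The spare bit receives the carry of
`add_sub_one_land_two_pow`, so lanes do not disturb each other. -/
theorem clash_packed {h m : ℕ} {t : ℕ → ℕ} (ht : ∀ i, t i < 2 ^ h) (g : ℕ) (hg : g < 2 ^ h) :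
    clash (2 ^ h) (packed (2 ^ (h + 1)) m fun _ => 1) (packed (2 ^ (h + 1)) m t) g =
      packed (2 ^ (h + 1)) m fun i => if t i &&& g = 0 then 0 else 1 := by
  have hpos : 0 < 2 ^ h := by positivity
  have hp : 2 ^ (h + 1) = 2 * 2 ^ h := pow_succ' 2 h
  change ((packed (2 ^ (h + 1)) m t &&& g * packed (2 ^ (h + 1)) m fun _ => 1) +
    (2 ^ h - 1) * (packed (2 ^ (h + 1)) m fun _ => 1) &&&
    2 ^ h * (packed (2 ^ (h + 1)) m fun _ => 1)) / 2 ^ h = _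
  have hlt : ∀ i, t i &&& g < 2 ^ h := fun i => lt_of_le_of_lt Nat.and_le_left (ht i)
  rw [mul_packed, mul_packed, mul_packed, packed_land (fun i => by have := ht i; omega)
    (fun i => by omega), packed_add, packed_land (fun i => by
      have := hlt i; simp only [mul_one]; omega) (fun i => by omega)]
  simp only [mul_one]
  rw [packed_congr fun i _ => add_sub_one_land_two_pow (hlt i), ← mul_packed,
    Nat.mul_div_cancel_left _ hpos]

/-- The subtraction from the all-ones indicator never borrows, and multiplication by `2 ^ h - 1`
turns each remaining `1` into a full mask. -/
theorem prune_packed {h m : ℕ} {t e : ℕ → ℕ} (ht : ∀ i, t i < 2 ^ h) (he : ∀ i, e i ≤ 1) :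
    prune (2 ^ h) (packed (2 ^ (h + 1)) m fun _ => 1) (packed (2 ^ (h + 1)) m t)
        (packed (2 ^ (h + 1)) m e) =
      packed (2 ^ (h + 1)) m fun i => if e i = 0 then t i else 0 := by
  have hp : 2 ^ (h + 1) = 2 * 2 ^ h := pow_succ' 2 h
  change packed (2 ^ (h + 1)) m t &&& (2 ^ h - 1) * ((packed (2 ^ (h + 1)) m fun _ => 1) -
    packed (2 ^ (h + 1)) m e) = _
  have hs : (packed (2 ^ (h + 1)) m fun _ => 1) - packed (2 ^ (h + 1)) m e =
      packed (2 ^ (h + 1)) m fun i => 1 - e i := by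
    apply Nat.sub_eq_of_eq_add
    rw [packed_add]
    refine packed_congr fun i _ => ?_
    have := he i
    omega
  rw [hs, mul_packed, packed_land (fun i => by have := ht i; omega) fun i => by
    have h1 : (2 ^ h - 1) * (1 - e i) ≤ (2 ^ h - 1) * 1 := Nat.mul_le_mul_left _ (by omega)
    have h2 : 0 < 2 ^ h := by positivity
    omega]
  refine packed_congr fun i _ => ?_
  have := he i
  rcases Nat.eq_zero_or_pos (e i) with h0 | h0
  · rw [if_pos h0, h0, Nat.sub_zero, mul_one, Nat.and_two_pow_sub_one_eq_mod,
      Nat.mod_eq_of_lt (ht i)]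
  · have : e i = 1 := by omega
    simp [this]

/-- `F &&& (F - 1)` clears the lowest digit `1` of `F`; in a packed indicator this digit marks the
first selected lane. -/
theorem lowBit_packed {w m : ℕ} (hw : w ≠ 0) {e : ℕ → ℕ} (he : ∀ i, e i ≤ 1)
    (h : packed (2 ^ w) m e ≠ 0) :
    ∃ q < m, e q = 1 ∧ lowBit (packed (2 ^ w) m e) = (2 ^ w) ^ q := by
  have hw2 : 2 ≤ 2 ^ w := Nat.le_self_pow hw 2
  induction m generalizing e with
  | zero => exact absurd packed_zero h
  | succ m ih =>
    rw [packed_succ] at h ⊢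
    set P := packed (2 ^ w) m fun i => e (i + 1) with hP
    change ∃ q < m + 1, e q = 1 ∧ (e 0 + 2 ^ w * P) - ((e 0 + 2 ^ w * P) &&&
      ((e 0 + 2 ^ w * P) - 1)) = (2 ^ w) ^ q
    have h0 := he 0
    rcases Nat.eq_zero_or_pos (e 0) with h1 | h1
    · rw [h1, zero_add] at h ⊢
      have hP0 : P ≠ 0 := fun h' => h (by rw [h', mul_zero])
      obtain ⟨q, hq, hq1, hq2⟩ := ih (e := fun i => e (i + 1)) (fun i => he _) hP0
      refine ⟨q + 1, by omega, hq1, ?_⟩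
      rw [← hP] at hq2
      change P - (P &&& (P - 1)) = _ at hq2
      have e1 : 2 ^ w * P - 1 = (2 ^ w - 1) + 2 ^ w * (P - 1) := by
        obtain ⟨p, hp⟩ := Nat.exists_eq_succ_of_ne_zero hP0
        rw [hp, Nat.succ_eq_add_one, mul_add, Nat.add_sub_cancel]
        omega
      have e2 := land_add_two_pow_mul (w := w) (a := 0) (b := P) (c := 2 ^ w - 1) (d := P - 1)
        (by omega) (by omega)
      rw [zero_add, ← e1, Nat.zero_and, zero_add] at e2
      rw [e2, ← Nat.mul_sub, hq2, pow_succ']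
    · have h2 : e 0 = 1 := by omega
      refine ⟨0, by omega, h2, ?_⟩
      rw [h2]
      have e2 := land_add_two_pow_mul (w := w) (a := 1) (b := P) (c := 0) (d := P)
        (by omega) (by omega)
      rw [zero_add, Nat.and_zero, zero_add, Nat.and_self] at e2
      rw [Nat.add_sub_cancel_left, e2]
      simp

end NearFactorization

namespace NearFactorization

/-! ### Exact covers -/

section search

/-- A bit of `U` lying in few of the lanes; `one` and `two` are masks of the bits
lying in two and in three of them. -/
def pickCommon (U one two : ℕ) : ℕ :=
  force (Nat.land (Nat.land U one) (Nat.sub U (Nat.land U two))) fun P =>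
    ifZero P (lowBit U) (lowBit P)

/-- Bits of `U` lying in no lane, or else a bit lying in few of them; `C₁`, `C₂`, `C₃` are
the binary digits of the multiplicities. -/
def pickDigits (U C₁ C₂ C₃ : ℕ) : ℕ :=
  force (Nat.sub U (Nat.land U (Nat.lor (Nat.lor C₁ C₂) C₃))) fun P =>
    ifZero P (force (Nat.land (Nat.land U C₁) (Nat.sub U (Nat.land U (Nat.lor C₂ C₃)))) fun P =>
      ifZero P (pickCommon U C₂ (Nat.lor C₁ C₃)) (lowBit P)) P

/-- Bits of `U` lying in few of the numbers packed by `T`, provided that `U` uses only the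
positions divisible by `3`. The multiplicities are found by casting out `W - 1`. -/
def pick (W U T : ℕ) : ℕ :=
  -- As `W` is `1` modulo `W - 1`, the remainder adds up the lanes. A factor of `k ≤ 7` elements
  -- covers each position at most `k` times, so three bits per position hold the count.
  force (Nat.mod T (Nat.sub W 1)) fun C =>
    force (Nat.shiftRight C 1) fun C₂ => force (Nat.shiftRight C 2) fun C₃ => pickDigits U C C₂ C₃

variable (W H o : ℕ)

/-- Try to extend by the number `t`, which `T` packs in the lane of lowest bit `D`. -/
def tryLane (cov : ℕ → ℕ → Bool) (U T : ℕ) (loop : ℕ → Bool) (D t : ℕ) : Bool :=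
  cond (force (Nat.xor U t) fun U' => force (clash H o T t) fun F => force (prune H o T F) (cov U'))
    true (force (Nat.sub T (Nat.mul t D)) loop)

/-- Try to extend by the first of the numbers that the indicator `F` selects. -/
def tryLow (cov : ℕ → ℕ → Bool) (U T : ℕ) (loop : ℕ → Bool) (F : ℕ) : Bool :=
  force (lowBit F) fun D => force (Nat.mod (Nat.div T D) W) (tryLane H o cov U T loop D)

/-- Try to extend by each of the numbers that meet `g`. -/
def tryAll (cov : ℕ → ℕ → Bool) (U g fuel : ℕ) : ℕ → Bool :=
  -- Exhausted fuel gives `true`, the harmless answer: only `false` is used as evidence.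
  Nat.rec (fun _ => true) (fun _ loop T => force (clash H o T g) fun F =>
    ifZero F false (tryLow W H o cov U T loop F)) fuel

/-- Try to cover the bits that `U` and `g` have in common. -/
def tryBits (cov : ℕ → ℕ → Bool) (U T g : ℕ) : Bool :=
  -- For `k ≤ 7` a single position lies in at most seven lanes, so eight rounds suffice: the last
  -- finds no lane left.
  force (Nat.land U g) fun g => ifZero g true (tryAll W H o cov U g 8 T)

/-- A search for an exact cover of the bits of `U` by numbers packed by `T`; `false` means
that there is none. -/
def cover (fuel : ℕ) : ℕ → ℕ → Bool :=
  Nat.rec (fun _ _ => true) (fun _ cov U T =>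
    ifZero U true (force (pick W U T) (tryBits W H o cov U T))) fuel

end search

/-- The numbers `t i` for `i ∈ S` cover the bits of `U` exactly. -/
structure IsCover (m : ℕ) (t : ℕ → ℕ) (U : ℕ) (S : Finset ℕ) : Prop where
  lt : ∀ i ∈ S, i < m
  disj : ∀ i ∈ S, ∀ j ∈ S, i ≠ j → t i &&& t j = 0
  bits : ∀ b, U.testBit b = true ↔ ∃ i ∈ S, (t i).testBit b = true

theorem land_ne_zero_iff {a b : ℕ} :
    a &&& b ≠ 0 ↔ ∃ i, a.testBit i = true ∧ b.testBit i = true := by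
  constructor
  · intro h
    obtain ⟨i, hi⟩ := Nat.exists_testBit_of_ne_zero h
    exact ⟨i, by simpa [Nat.testBit_land] using hi⟩
  · rintro ⟨i, h1, h2⟩ h
    have : (a &&& b).testBit i = true := by simp [h1, h2]
    simp [h] at this

namespace IsCover

variable {m U : ℕ} {t t' : ℕ → ℕ} {S : Finset ℕ}

theorem congr (hc : IsCover m t U S) (h : ∀ i ∈ S, t' i = t i) : IsCover m t' U S where
  lt := hc.lt
  disj i hi j hj hij := by rw [h i hi, h j hj]; exact hc.disj i hi j hj hij
  bits b := by
    rw [hc.bits]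
    exact exists_congr fun i => and_congr_right fun hi => by rw [h i hi]

/-- The bits of `t q` lie in `U`, so the exclusive or deletes them; by disjointness the other
members cover just what remains. -/
theorem erase (hc : IsCover m t U S) {q : ℕ} (hq : q ∈ S) :
    IsCover m t (U ^^^ t q) (S.erase q) where
  lt i hi := hc.lt i (Finset.mem_of_mem_erase hi)
  disj i hi j hj := hc.disj i (Finset.mem_of_mem_erase hi) j (Finset.mem_of_mem_erase hj)
  bits b := by
    have key : ∀ i ∈ S, i ≠ q → (t i).testBit b = true → (t q).testBit b = false := by
      intro i hi hiq h
      by_contra h'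
      exact land_ne_zero_iff.2 ⟨b, h, by simpa using h'⟩ (hc.disj i hi q hq hiq)
    rw [Nat.testBit_xor]
    constructor
    · intro h
      by_cases hb : (t q).testBit b = true
      · have : U.testBit b = true := (hc.bits b).2 ⟨q, hq, hb⟩
        simp [hb, this] at h
      · have hU : U.testBit b = true := by
          rw [Bool.not_eq_true] at hb
          simpa [hb] using h
        obtain ⟨i, hi, hib⟩ := (hc.bits b).1 hU
        refine ⟨i, Finset.mem_erase.2 ⟨?_, hi⟩, hib⟩
        rintro rfl
        exact hb hib
    · rintro ⟨i, hi, hib⟩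
      have hi' := Finset.mem_erase.1 hi
      have hU : U.testBit b = true := (hc.bits b).2 ⟨i, hi'.2, hib⟩
      simp [hU, key i hi'.2 hi'.1 hib]

theorem lt_two_pow (hc : IsCover m t U S) {h : ℕ} (ht : ∀ i, t i < 2 ^ h) : U < 2 ^ h := by
  apply Nat.lt_pow_two_of_testBit
  intro b hb
  by_contra hU
  rw [Bool.not_eq_false] at hU
  obtain ⟨i, -, hi⟩ := (hc.bits b).1 hU
  rw [Nat.testBit_lt_two_pow (lt_of_lt_of_le (ht i) (Nat.pow_le_pow_right two_pos hb))] at hi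
  exact Bool.noConfusion hi

end IsCover

/-! ### Correctness of the exact cover search. -/

section soundness

variable {m h : ℕ}

/-- Clashing lanes become `0` instead of disappearing: indices stay fixed, and a zero lane meets
nothing, so it is never tried again. -/
theorem prune_clash {t : ℕ → ℕ} (ht : ∀ i, t i < 2 ^ h) {g : ℕ} (hg : g < 2 ^ h) :
    prune (2 ^ h) (packed (2 ^ (h + 1)) m fun _ => 1) (packed (2 ^ (h + 1)) m t)
        (clash (2 ^ h) (packed (2 ^ (h + 1)) m fun _ => 1) (packed (2 ^ (h + 1)) m t) g) =
      packed (2 ^ (h + 1)) m fun i => if t i &&& g = 0 then t i else 0 := by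
  rw [clash_packed ht g hg, prune_packed ht fun i => by split_ifs <;> simp]
  refine packed_congr fun i _ => ?_
  by_cases h0 : t i &&& g = 0 <;> simp [h0]

/-- Let `q` be the first lane meeting `g`. If `q ∈ S`, then `S.erase q` covers the rest and survives
the pruning, so `cov` succeeds. If not, clearing lane `q` leaves the cover intact and the loop goes
on. -/
theorem tryAll_eq_true {cov : ℕ → ℕ → Bool} {U g : ℕ}
    (hcov : ∀ U S (t : ℕ → ℕ), (∀ i, t i < 2 ^ h) → IsCover m t U S →
      cov U (packed (2 ^ (h + 1)) m t) = true) (hg : g < 2 ^ h) (fuel : ℕ) :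
    ∀ (S : Finset ℕ) (t : ℕ → ℕ), (∀ i, t i < 2 ^ h) → IsCover m t U S →
      (∃ i ∈ S, t i &&& g ≠ 0) →
      tryAll (2 ^ (h + 1)) (2 ^ h) (packed (2 ^ (h + 1)) m fun _ => 1) cov U g fuel
        (packed (2 ^ (h + 1)) m t) = true := by
  have hW : 2 ^ h < 2 ^ (h + 1) := Nat.pow_lt_pow_right (by norm_num) (Nat.lt_succ_self h)
  induction fuel with
  | zero => intros; rfl
  | succ fuel ih =>
    intro S t ht hc hi
    change force _ _ = true
    rw [force_eq, ifZero_eq, clash_packed ht g hg]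
    set e : ℕ → ℕ := fun i => if t i &&& g = 0 then 0 else 1 with he
    have he1 : ∀ i, e i ≤ 1 := fun i => by rw [he]; dsimp only; split_ifs <;> simp
    have hne : packed (2 ^ (h + 1)) m e ≠ 0 := by
      obtain ⟨i, hiS, hig⟩ := hi
      intro h0
      have := (Finset.sum_eq_zero_iff.1 h0) i (Finset.mem_range.2 (hc.lt i hiS))
      simp [he, hig] at this
    rw [if_neg hne]
    obtain ⟨q, hqm, hq1, hq2⟩ := lowBit_packed (Nat.succ_ne_zero h) he1 hne
    change force _ _ = true
    rw [force_eq, force_eq, hq2]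
    change cond (force _ _) true (force _ _) = true
    have hlane : 
        ((packed (2 ^ (h + 1)) m t).div ((2 ^ (h + 1)) ^ q)).mod (2 ^ (h + 1)) = t q :=
      packed_div_mod (by positivity) (fun i => (ht i).trans hW) hqm
    rw [hlane, force_eq, force_eq, force_eq, force_eq, prune_clash ht (ht q)]
    have hsub : (packed (2 ^ (h + 1)) m t).sub ((t q).mul ((2 ^ (h + 1)) ^ q)) =
      packed (2 ^ (h + 1)) m (Function.update t q 0) := packed_sub_update hqm
    rw [hsub]
    by_cases hqS : q ∈ S
    · have : cov (U.xor (t q)) (packed (2 ^ (h + 1)) m fun i => if t i &&& t q = 0 then t i else 0)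
          = true := by
        refine hcov _ (S.erase q) _ (fun i => ?_) ((hc.erase hqS).congr fun i hi => ?_)
        · split_ifs
          · exact ht i
          · positivity
        · have hi' := Finset.mem_erase.1 hi
          rw [if_pos (hc.disj i hi'.2 q hqS hi'.1)]
      rw [this]
      rfl
    · have hne' : ∀ i ∈ S, Function.update t q 0 i = t i := fun i hi =>
        Function.update_of_ne (ne_of_mem_of_not_mem hi hqS) _ _
      have := ih S (Function.update t q 0) (fun i => ?_) (hc.congr hne') ?_
      · change cond _ true (tryAll _ _ _ cov U g fuel _) = true
        rw [this]
        cases cov _ _ <;> rfl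
      · by_cases hiq : i = q
        · subst hiq; simp
        · rw [Function.update_of_ne hiq]; exact ht i
      · obtain ⟨i, hiS, hig⟩ := hi
        exact ⟨i, hiS, by rwa [hne' i hiS]⟩

/-- The search succeeds if there is an exact cover. -/
theorem cover_eq_true (fuel : ℕ) :
    ∀ (U : ℕ) (S : Finset ℕ) (t : ℕ → ℕ), (∀ i, t i < 2 ^ h) → IsCover m t U S →
      cover (2 ^ (h + 1)) (2 ^ h) (packed (2 ^ (h + 1)) m fun _ => 1) fuel U
        (packed (2 ^ (h + 1)) m t) = true := by
  induction fuel with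
  | zero => intros; rfl
  | succ fuel ih =>
    intro U S t ht hc
    change ifZero _ _ (force _ _) = true
    rw [ifZero_eq, force_eq]
    split_ifs with hU
    · rfl
    -- `pick` is a mere heuristic: any common bit of `U` and `g` must be covered by a member of `S`,
    -- whatever `g` is.
    · generalize pick (2 ^ (h + 1)) U (packed (2 ^ (h + 1)) m t) = g
      change force _ _ = true
      rw [force_eq, ifZero_eq]
      split_ifs with hg
      · rfl
      · obtain ⟨b, hb⟩ := Nat.exists_testBit_of_ne_zero hg
        have hb' : (U &&& g).testBit b = true := hb
        have hUb : U.testBit b = true := by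
          rw [Nat.testBit_land, Bool.and_eq_true] at hb'
          exact hb'.1
        obtain ⟨i, hiS, hib⟩ := (hc.bits b).1 hUb
        exact tryAll_eq_true ih (lt_of_le_of_lt Nat.and_le_left (hc.lt_two_pow ht)) 8 S t ht hc
          ⟨i, hiS, land_ne_zero_iff.2 ⟨b, hib, hb'⟩⟩

end soundness

end NearFactorization

namespace NearFactorization

/-! ### Near-factorizations of groups -/

section group

variable {G : Type*} [Group G]

/-! ### Sums of subsets in the group algebra. -/

section indicator

/-- The sum of the elements of `S` in the rational group algebra. -/
noncomputable def groupSum (S : Finset G) : MonoidAlgebra ℚ G :=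
  ∑ g ∈ S, MonoidAlgebra.single g 1

theorem groupSum_mul_univ [Fintype G] (A : Finset G) :
    groupSum A * groupSum Finset.univ = (A.card : ℚ) • groupSum (Finset.univ : Finset G) := by
  have h : ∀ g : G, MonoidAlgebra.single g (1 : ℚ) * groupSum Finset.univ =
      groupSum Finset.univ := by
    intro g
    simp only [groupSum, Finset.mul_sum, MonoidAlgebra.single_mul_single, one_mul]
    exact Fintype.sum_equiv (Equiv.mulLeft g) _ _ fun _ => rfl
  conv_lhs => rw [groupSum, Finset.sum_mul]
  simp only [h, Finset.sum_const, Nat.cast_smul_eq_nsmul]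

theorem univ_mul_groupSum [Fintype G] (A : Finset G) :
    groupSum Finset.univ * groupSum A = (A.card : ℚ) • groupSum (Finset.univ : Finset G) := by
  have h : ∀ g : G, groupSum Finset.univ * MonoidAlgebra.single g (1 : ℚ) =
      groupSum Finset.univ := by
    intro g
    simp only [groupSum, Finset.sum_mul, MonoidAlgebra.single_mul_single, one_mul]
    exact Fintype.sum_equiv (Equiv.mulRight g) _ _ fun _ => rfl
  conv_lhs => rw [groupSum.eq_def A, Finset.mul_sum]
  simp only [h, Finset.sum_const, Nat.cast_smul_eq_nsmul]

variable [DecidableEq G]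

theorem groupSum_apply {G : Type*} [DecidableEq G] (S : Finset G) (x : G) :
    (groupSum S).coeff x = if x ∈ S then 1 else 0 := by
  rw [groupSum, MonoidAlgebra.coeff_sum, Finsupp.finsetSum_apply]
  simp [Finsupp.single_apply]

omit [Group G] in
theorem groupSum_injective : Function.Injective (groupSum : Finset G → MonoidAlgebra ℚ G) := by
  intro S T h
  ext x
  have := congrArg (fun f : MonoidAlgebra ℚ G => f.coeff x) h
  simp only [groupSum_apply] at this
  by_cases h1 : x ∈ S <;> by_cases h2 : x ∈ T <;> simp_all

theorem groupSum_mul_apply (A B : Finset G) (x : G) :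
    (groupSum A * groupSum B).coeff x = ((A ×ˢ B).filter fun p => p.1 * p.2 = x).card := by
  rw [groupSum, groupSum, Finset.sum_mul_sum, ← Finset.sum_product', MonoidAlgebra.coeff_sum,
    Finsupp.finsetSum_apply]
  simp [MonoidAlgebra.single_mul_single, Finsupp.single_apply, Finset.sum_boole]

/-- The cardinality condition makes multiplication injective on `A × B`, so every product has
coefficient `1`. -/
theorem groupSum_mul {A B : Finset G} (h : (A * B).card = A.card * B.card) :
    groupSum A * groupSum B = groupSum (A * B) := by
  have hinj := Finset.card_mul_iff.1 h
  rw [groupSum, groupSum, Finset.sum_mul_sum, ← Finset.sum_product', groupSum,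
    ← Finset.image_mul_product, Finset.sum_image (by simpa using hinj)]
  simp [MonoidAlgebra.single_mul_single]

theorem groupSum_univ_sdiff_one [Fintype G] :
    groupSum (Finset.univ \ {1} : Finset G) = groupSum Finset.univ - 1 := by
  rw [eq_sub_iff_add_eq, groupSum, groupSum, MonoidAlgebra.one_def]
  have := Finset.sum_sdiff (Finset.subset_univ ({1} : Finset G))
    (f := fun g => MonoidAlgebra.single g (1 : ℚ))
  simpa only [Finset.sum_singleton] using this

end indicator

variable [DecidableEq G] {k l : ℕ} {A B A' B' : Finset G}

/-- Inversion reverses products and commutes with automorphisms. This is what allows the assumption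
`k ≤ l`. -/
theorem nearFactorizationEquiv_of_inv
    (h : NearFactorizationEquiv B⁻¹ A⁻¹ B'⁻¹ A'⁻¹) : NearFactorizationEquiv A B A' B' := by
  obtain ⟨f, x, h1, h2⟩ := h
  have key : ∀ S : Finset G, (S⁻¹.image f)⁻¹ = S.image f := by
    intro S
    ext y
    simp only [Finset.mem_inv', Finset.mem_image]
    constructor
    · rintro ⟨z, hz, hy⟩
      exact ⟨z⁻¹, hz, by rw [map_inv, hy, inv_inv]⟩
    · rintro ⟨z, hz, rfl⟩
      exact ⟨z⁻¹, by simpa using hz, map_inv f z⟩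
  refine ⟨f, x, ?_, ?_⟩
  · rw [← inv_inj, h2, mul_inv_rev, Finset.inv_singleton, ← key A, inv_inv]
  · rw [← inv_inj, h1, mul_inv_rev, Finset.inv_singleton, inv_inv, ← key B, inv_inv]

/-- The relation of equivalence for single factors. -/
def FactorEquiv (A A' : Finset G) : Prop := ∃ (f : MulAut G) (h : G), A' = A.image f * {h}

theorem FactorEquiv.trans {C : Finset G} (h₁ : FactorEquiv A A') (h₂ : FactorEquiv A' C) :
    FactorEquiv A C := by
  obtain ⟨f, x, rfl⟩ := h₁
  obtain ⟨g, y, rfl⟩ := h₂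
  refine ⟨g * f, g x * y, ?_⟩
  rw [Finset.image_mul, Finset.image_singleton, mul_assoc, Finset.singleton_mul_singleton,
    Finset.image_image]
  rfl

theorem FactorEquiv.symm (h : FactorEquiv A A') : FactorEquiv A' A := by
  obtain ⟨f, x, rfl⟩ := h
  refine ⟨f⁻¹, f⁻¹ x⁻¹, ?_⟩
  rw [Finset.image_mul, Finset.image_singleton, mul_assoc, Finset.singleton_mul_singleton,
    ← map_mul, mul_inv_cancel, map_one, Finset.singleton_one, mul_one, Finset.image_image]
  have : (⇑f⁻¹ ∘ ⇑f) = id := funext fun y => MulAut.inv_apply_self _ f y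
  rw [this, Finset.image_id]

section finite

variable [Fintype G]

theorem card_mul_of_isNearFactorization (h : IsNearFactorization k l A B) :
    (A * B).card = A.card * B.card := by
  rw [h.2.2.1, h.2.2.2, Finset.card_sdiff_of_subset (Finset.subset_univ _)]
  simp

theorem groupSum_mul_of_isNearFactorization (h : IsNearFactorization k l A B) :
    groupSum A * groupSum B = groupSum Finset.univ - 1 := by
  rw [groupSum_mul (card_mul_of_isNearFactorization h), h.2.2.2, groupSum_univ_sdiff_one]

/-- The first factor is invertible in the rational group algebra. -/
theorem groupSum_mul_inverse (h : IsNearFactorization k l A B) (hA : A.Nonempty) :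
    groupSum A * ((A.card : ℚ)⁻¹ • groupSum Finset.univ - groupSum B) = 1 := by
  have hc : (A.card : ℚ) ≠ 0 := by exact_mod_cast hA.card_pos.ne'
  -- `A * (|A|⁻¹ G - B) = G - (G - 1) = 1`.
  rw [mul_sub, groupSum_mul_of_isNearFactorization h, mul_smul_comm, groupSum_mul_univ, smul_smul,
    inv_mul_cancel₀ hc, one_smul, sub_sub_cancel]

/-- In a finite-dimensional algebra a one-sided inverse is two-sided. -/
theorem inverse_mul_groupSum (h : IsNearFactorization k l A B) (hA : A.Nonempty) :
    ((A.card : ℚ)⁻¹ • groupSum Finset.univ - groupSum B) * groupSum A = 1 :=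
  mul_eq_one_comm.1 (groupSum_mul_inverse h hA)

/-- The factors of a near-factorization commute. -/
theorem isNearFactorization_swap (h : IsNearFactorization k l A B) (hA : A.Nonempty) :
    IsNearFactorization l k B A := by
  have hc : (A.card : ℚ) ≠ 0 := by exact_mod_cast hA.card_pos.ne'
  -- Expanded, this is `B * A = G - 1` in the group algebra; its coefficients count the
  -- factorizations of each element.
  have h1 := inverse_mul_groupSum h hA
  rw [sub_mul, smul_mul_assoc, univ_mul_groupSum, smul_smul, inv_mul_cancel₀ hc, one_smul,
    sub_eq_iff_eq_add, add_comm, ← sub_eq_iff_eq_add, ← groupSum_univ_sdiff_one] at h1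
  refine ⟨h.2.1, h.1, by rw [mul_comm, h.2.2.1], ?_⟩
  ext x
  have h2 := congrArg (fun f : MonoidAlgebra ℚ G => f.coeff x) h1
  simp only [groupSum_apply, groupSum_mul_apply] at h2
  rw [Finset.mem_mul]
  constructor
  · rintro ⟨b, hb, a, ha, rfl⟩
    by_contra hx
    rw [if_neg hx] at h2
    have h3 : ((B ×ˢ A).filter fun p => p.1 * p.2 = b * a).card = 0 := by exact_mod_cast h2.symm
    rw [Finset.card_eq_zero] at h3
    have : (b, a) ∈ (B ×ˢ A).filter fun p => p.1 * p.2 = b * a := by simp [hb, ha]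
    simp [h3] at this
  · intro hx
    rw [if_pos hx] at h2
    have h3 : ((B ×ˢ A).filter fun p => p.1 * p.2 = x).card = 1 := by exact_mod_cast h2.symm
    obtain ⟨⟨b, a⟩, hp⟩ := Finset.card_pos.1 (h3.symm ▸ Nat.one_pos)
    simp only [Finset.mem_filter, Finset.mem_product] at hp
    exact ⟨b, hp.1.1, a, hp.1.2, hp.2⟩

/-- The first factor determines the second. -/
theorem right_unique (h : IsNearFactorization k l A B) (h' : IsNearFactorization k l A B')
    (hA : A.Nonempty) : B = B' := by
  have h1 := groupSum_mul_of_isNearFactorization h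
  rw [← groupSum_mul_of_isNearFactorization h'] at h1
  have h2 := congrArg (((A.card : ℚ)⁻¹ • groupSum Finset.univ - groupSum B) * ·) h1
  simp only [← mul_assoc, inverse_mul_groupSum h hA, one_mul] at h2
  exact groupSum_injective h2

theorem mul_inj_of_isNearFactorization (h : IsNearFactorization k l A B) {a a' b b' : G}
    (ha : a ∈ A) (ha' : a' ∈ A) (hb : b ∈ B) (hb' : b' ∈ B) (heq : a * b = a' * b') :
    a = a' ∧ b = b' := by
  have hinj := Finset.card_mul_iff.1 (card_mul_of_isNearFactorization h)
  have := @hinj (a, b) ⟨ha, hb⟩ (a', b') ⟨ha', hb'⟩ heq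
  simpa using this

/-- A nontrivial character with values `±1` takes the values `±1` on the factors. -/
theorem sum_char_eq (h : IsNearFactorization k l A B) (χ : G →* ℤ) (hχ : ∑ g, χ g = 0) :
    ∑ g ∈ A, χ g = 1 ∨ ∑ g ∈ A, χ g = -1 := by
  have hinj := Finset.card_mul_iff.1 (card_mul_of_isNearFactorization h)
  -- The product of the two character sums is `χ(G) - χ(1) = -1`, an equation between integers.
  have h1 : (∑ g ∈ A, χ g) * ∑ g ∈ B, χ g = ∑ g ∈ A * B, χ g := by
    rw [Finset.sum_mul_sum, ← Finset.sum_product', ← Finset.image_mul_product,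
      Finset.sum_image (by simpa using hinj)]
    simp
  have h2 := Finset.sum_sdiff (Finset.subset_univ ({1} : Finset G)) (f := fun g => χ g)
  rw [hχ, Finset.sum_singleton, map_one] at h2
  rw [h.2.2.2] at h1
  exact Int.eq_one_or_neg_one_of_mul_eq_neg_one (by rw [h1]; omega)

theorem isNearFactorization_image (h : IsNearFactorization k l A B) (f : MulAut G) (x : G) :
    IsNearFactorization k l (A.image f * {x}) ({x⁻¹} * B.image f) := by
  have h1 : (A.image f * {x}).card = A.card := by
    rw [Finset.card_mul_singleton, Finset.card_image_of_injective _ f.injective]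
  have h2 : ({x⁻¹} * B.image f).card = B.card := by
    rw [Finset.card_singleton_mul, Finset.card_image_of_injective _ f.injective]
  refine ⟨h1.trans h.1, h2.trans h.2.1, by rw [h1, h2, h.2.2.1], ?_⟩
  rw [mul_assoc, ← mul_assoc ({x} : Finset G), Finset.singleton_mul_singleton, mul_inv_cancel,
    Finset.singleton_one, one_mul, ← Finset.image_mul, h.2.2.2]
  ext y
  simp only [Finset.mem_image, Finset.mem_sdiff, Finset.mem_univ, true_and, Finset.mem_singleton]
  constructor
  · rintro ⟨z, hz, rfl⟩ h'
    exact hz (by simpa using h')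
  · intro hy
    exact ⟨f.symm y, fun h' => hy (by simpa using h'), by simp⟩

theorem isNearFactorization_inv (h : IsNearFactorization k l A B) :
    IsNearFactorization l k B⁻¹ A⁻¹ := by
  refine ⟨by rw [Finset.card_inv, h.2.1], by rw [Finset.card_inv, h.1], ?_, ?_⟩
  · rw [Finset.card_inv, Finset.card_inv, mul_comm, h.2.2.1]
  · rw [← mul_inv_rev, h.2.2.2]
    ext y
    simp

/-- The equivalence carries `B` to a mate of `A'`, and mates are unique. -/
theorem nearFactorizationEquiv_of_factorEquiv (h : IsNearFactorization k l A B)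
    (h' : IsNearFactorization k l A' B') (hA : A'.Nonempty) (he : FactorEquiv A A') :
    NearFactorizationEquiv A B A' B' := by
  obtain ⟨f, x, rfl⟩ := he
  exact ⟨f, x, rfl, right_unique h' (isNearFactorization_image h f x) hA⟩

theorem FactorEquiv.exists_isNearFactorization (h : IsNearFactorization k l A B)
    (he : FactorEquiv A A') : ∃ B', IsNearFactorization k l A' B' := by
  obtain ⟨f, x, rfl⟩ := he
  exact ⟨_, isNearFactorization_image h f x⟩

end finite

end group

end NearFactorization

namespace NearFactorization

/-! ### Subsets of dihedral groups -/

open DihedralGroup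

variable {n : ℕ}

/-- The set of the rotations `r i`, `i ∈ S`, and the reflections `sr i`, `i ∈ T`. -/
def dihedralSet (S T : Finset (ZMod n)) : Finset (DihedralGroup n) := S.image r ∪ T.image sr

section dihedralSet

variable {S T S' T' : Finset (ZMod n)} {i : ZMod n}

@[simp] theorem r_mem_dihedralSet : r i ∈ dihedralSet S T ↔ i ∈ S := by simp [dihedralSet]

@[simp] theorem sr_mem_dihedralSet : sr i ∈ dihedralSet S T ↔ i ∈ T := by simp [dihedralSet]

theorem exists_eq_dihedralSet [NeZero n] (A : Finset (DihedralGroup n)) :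
    ∃ S T, A = dihedralSet S T := by
  refine ⟨Finset.univ.filter fun i => r i ∈ A, Finset.univ.filter fun i => sr i ∈ A, ?_⟩
  ext (i | i) <;> simp

theorem sum_dihedralSet (f : DihedralGroup n → ℤ) :
    ∑ g ∈ dihedralSet S T, f g = ∑ i ∈ S, f (r i) + ∑ i ∈ T, f (sr i) := by
  rw [dihedralSet, Finset.sum_union, Finset.sum_image (fun _ _ _ _ h => r.inj h),
    Finset.sum_image (fun _ _ _ _ h => sr.inj h)]
  rw [Finset.disjoint_left]
  simp

theorem card_dihedralSet : (dihedralSet S T).card = S.card + T.card := by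
  rw [dihedralSet, Finset.card_union_of_disjoint,
    Finset.card_image_of_injective _ fun _ _ h => r.inj h,
    Finset.card_image_of_injective _ fun _ _ h => sr.inj h]
  rw [Finset.disjoint_left]
  simp

theorem dihedralSet_mul_r (x : ZMod n) :
    dihedralSet S T * {r x} = dihedralSet (S.image (· + x)) (T.image (· + x)) := by
  rw [Finset.mul_singleton, dihedralSet, dihedralSet, Finset.smul_finset_union]
  simp only [Finset.smul_finset_def, Finset.image_image]
  rfl

theorem dihedralSet_mul_sr (x : ZMod n) :
    dihedralSet S T * {sr x} = dihedralSet (T.image (x - ·)) (S.image (x - ·)) := by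
  rw [Finset.mul_singleton, dihedralSet, dihedralSet, Finset.smul_finset_union, Finset.union_comm]
  simp only [Finset.smul_finset_def, Finset.image_image]
  rfl

/-- The automorphism `r i ↦ r (u * i)`, `sr i ↦ sr (u * i + v)`. -/
def affineAut (u : (ZMod n)ˣ) (v : ZMod n) : MulAut (DihedralGroup n) where
  toFun
    | r i => r (u * i)
    | sr i => sr (u * i + v)
  invFun
    | r i => r (↑u⁻¹ * i)
    | sr i => sr (↑u⁻¹ * (i - v))
  left_inv := by rintro (i | i) <;> simp
  right_inv := by rintro (i | i) <;> simp
  map_mul' := by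
    rintro (i | i) (j | j) <;> simp [mul_add, mul_sub] <;> ring

theorem image_affineAut (u : (ZMod n)ˣ) (v : ZMod n) :
    (dihedralSet S T).image (affineAut u v) =
      dihedralSet (S.image fun i => (u : ZMod n) * i) (T.image fun i => (u : ZMod n) * i + v) := by
  rw [dihedralSet, dihedralSet, Finset.image_union]
  simp only [Finset.image_image]
  rfl

/-- An automorphism can shift the reflections alone, so the two sets are translated independently;
only the multiplier `u` is shared. -/
theorem factorEquiv_dihedralSet (u : (ZMod n)ˣ) (x y : ZMod n) :
    FactorEquiv (dihedralSet S T)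
      (dihedralSet (S.image fun i => u * (i - x)) (T.image fun i => u * (i - y))) := by
  -- Right multiplication shifts both sets by `-(u * x)`; the shift `u * (x - y)` of the reflections
  -- corrects this to `-(u * y)`.
  refine ⟨affineAut u (u * (x - y)), r (-(u * x)), ?_⟩
  rw [image_affineAut, dihedralSet_mul_r, Finset.image_image, Finset.image_image]
  congr 1 <;> refine Finset.image_congr fun i _ => ?_ <;> simp only [Function.comp] <;> ring

theorem factorEquiv_dihedralSet_swap :
    FactorEquiv (dihedralSet S T) (dihedralSet (T.image (0 - ·)) (S.image (0 - ·))) :=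
  ⟨1, sr 0, by rw [← dihedralSet_mul_sr]; congr 1; ext; simp⟩

end dihedralSet

section characters

theorem sum_neg_one_pow_val (S : Finset (ZMod n)) :
    ∑ i ∈ S, (-1 : ℤ) ^ i.val = S.card - 2 * ∑ i ∈ S, (i.val % 2 : ℕ) := by
  rw [Finset.cast_card, Nat.cast_sum, Finset.mul_sum, ← Finset.sum_sub_distrib]
  refine Finset.sum_congr rfl fun i _ => ?_
  rcases Nat.even_or_odd i.val with hi | hi
  · rw [hi.neg_one_pow, Nat.even_iff.1 hi]; simp
  · rw [hi.neg_one_pow, Nat.odd_iff.1 hi]; norm_num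

variable [NeZero n]

/-- The character `r i ↦ ε i`, `sr i ↦ δ * ε i` of the dihedral group. -/
def dihedralChar (ε : ZMod n → ℤ) (δ : ℤ) (h0 : ε 0 = 1) (hadd : ∀ i j, ε (i + j) = ε i * ε j)
    (hneg : ∀ i, ε (-i) = ε i) (hδ : δ * δ = 1) : DihedralGroup n →* ℤ where
  toFun
    | r i => ε i
    | sr i => δ * ε i
  map_one' := h0
  map_mul' := by
    have hsub : ∀ i j, ε (i - j) = ε i * ε j := fun i j => by rw [sub_eq_add_neg, hadd, hneg]
    rintro (i | i) (j | j)
    · exact hadd i j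
    · change δ * ε (j - i) = ε i * (δ * ε j)
      rw [hsub]; ring
    · change δ * ε (i + j) = δ * ε i * ε j
      rw [hadd]; ring
    · change ε (j - i) = δ * ε i * (δ * ε j)
      rw [hsub]; linear_combination (-(ε i * ε j)) * hδ

variable {k l : ℕ} {S T : Finset (ZMod n)} {B : Finset (DihedralGroup n)}

/-- The hypothesis `hsum` says that the character sums to zero over the group, that is, that it is
nontrivial. -/
theorem sum_add_mul_sum (h : IsNearFactorization k l (dihedralSet S T) B) (ε : ZMod n → ℤ) (δ : ℤ)
    (h0 : ε 0 = 1) (hadd : ∀ i j, ε (i + j) = ε i * ε j) (hneg : ∀ i, ε (-i) = ε i)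
    (hδ : δ * δ = 1) (hsum : (1 + δ) * ∑ i, ε i = 0) :
    ∑ i ∈ S, ε i + δ * ∑ i ∈ T, ε i = 1 ∨ ∑ i ∈ S, ε i + δ * ∑ i ∈ T, ε i = -1 := by
  have key : ∀ S T : Finset (ZMod n),
      ∑ g ∈ dihedralSet S T, dihedralChar ε δ h0 hadd hneg hδ g =
        ∑ i ∈ S, ε i + δ * ∑ i ∈ T, ε i := by
    intro S T
    rw [sum_dihedralSet, Finset.mul_sum]
    rfl
  rw [← key]
  refine sum_char_eq h _ ?_
  have hu : (Finset.univ : Finset (DihedralGroup n)) = dihedralSet Finset.univ Finset.univ := by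
    ext (i | i) <;> simp
  rw [hu, key]
  linear_combination hsum

/-- Apply the character that is `1` on rotations and `-1` on reflections. -/
theorem card_sub_card (h : IsNearFactorization k l (dihedralSet S T) B) :
    S.card = T.card + 1 ∨ T.card = S.card + 1 := by
  have := sum_add_mul_sum h (fun _ => 1) (-1) rfl (by simp) (by simp) (by norm_num) (by simp)
  simp only [Finset.sum_const, nsmul_eq_mul, mul_one] at this
  omega

/-- For even `n` there are two further sign characters, `(-1) ^ i` on rotations and `±(-1) ^ i` on
reflections. If `s` and `t` are the alternating sums over `S` and `T`, then `s + t` and `s - t` are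
both `±1`, whence `|s|, |t| ≤ 1`. -/
theorem card_parity (hn : Even n) (h : IsNearFactorization k l (dihedralSet S T) B) :
    (2 * ∑ i ∈ S, i.val % 2 ≤ S.card + 1 ∧ S.card ≤ 2 * (∑ i ∈ S, i.val % 2) + 1) ∧
      2 * ∑ i ∈ T, i.val % 2 ≤ T.card + 1 ∧ T.card ≤ 2 * (∑ i ∈ T, i.val % 2) + 1 := by
  set ε : ZMod n → ℤ := fun i => (-1) ^ i.val with hε
  have h0 : ε 0 = 1 := by simp [hε]
  have hadd : ∀ i j, ε (i + j) = ε i * ε j := by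
    intro i j
    simp only [hε]
    rw [← pow_add, ZMod.val_add, neg_one_pow_eq_pow_mod_two, neg_one_pow_eq_pow_mod_two (i.val + _),
      Nat.mod_mod_of_dvd _ hn.two_dvd]
  have hsq : ∀ i, ε i * ε i = 1 := fun i => by
    simp only [hε]
    rw [← pow_add]
    exact (Even.add_self _).neg_one_pow
  have hneg : ∀ i, ε (-i) = ε i := by
    intro i
    have h1 : ε (-i) * ε i = 1 := by rw [← hadd, neg_add_cancel, h0]
    calc ε (-i) = ε (-i) * (ε i * ε i) := by rw [hsq, mul_one]
      _ = ε i := by rw [← mul_assoc, h1, one_mul]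
  have hsum : ∑ i, ε i = 0 := by
    have h1 : ε 1 = -1 := by
      have hn2 : 1 < n := by
        have := NeZero.ne n
        obtain ⟨c, hc⟩ := hn
        omega
      have : Fact (1 < n) := ⟨hn2⟩
      simp [hε, ZMod.val_one]
    -- Translation by `1` preserves the sum and also negates it.
    have h2 : ∑ i, ε (i + 1) = ∑ i, ε i := Fintype.sum_equiv (Equiv.addRight 1) _ _ fun _ => rfl
    simp only [hadd, h1, mul_neg, mul_one, Finset.sum_neg_distrib] at h2
    omega
  have h1 := sum_add_mul_sum h ε 1 h0 hadd hneg (by norm_num) (by rw [hsum, mul_zero])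
  have h2 := sum_add_mul_sum h ε (-1) h0 hadd hneg (by norm_num) (by rw [hsum, mul_zero])
  simp only [hε] at h1 h2
  rw [sum_neg_one_pow_val, sum_neg_one_pow_val] at h1 h2
  omega

end characters

/-! ### Existence -/

/-- The factor consisting of `m + 1` consecutive rotations and `m` consecutive reflections. -/
def intervalFactor (n m : ℕ) : Finset (DihedralGroup n) :=
  dihedralSet ((Finset.range (m + 1)).image (↑)) ((Finset.range m).image (↑))

/-- The second factor belonging to `intervalFactor`. -/
def intervalCofactor (n m c : ℕ) : Finset (DihedralGroup n) :=
  dihedralSet ((Finset.range c).image fun j => ((m + 1 + (2 * m + 1) * j : ℕ) : ZMod n))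
    ((Finset.range (c + 1)).image fun j => ((m + (2 * m + 1) * j : ℕ) : ZMod n))

/-- Put `d = 2 * m + 1`, so `n = d * c + m + 1`. With the `j`-th terms of the progressions, the
rotations obtained are `d * j + 1, …, d * j + m` from two reflections and `d * j + m + 1, …, d * j +
d` from two rotations. The reflections obtained are `d * j, …, d * j + m` and `d * j + m + 1, …, d *
j + 2 * m`. The blocks are consecutive, and the half block at `j = c` ends at `n - 1`. -/
theorem subset_intervalFactor_mul [NeZero n] {m c : ℕ} (h : (2 * m + 1) * (2 * c + 1) = 2 * n - 1) :
    Finset.univ \ {1} ⊆ intervalFactor n m * intervalCofactor n m c := by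
  have hn := NeZero.pos n
  have hn' : (2 * m + 1) * c + m + 1 = n := by
    have : (2 * m + 1) * (2 * c + 1) = 2 * ((2 * m + 1) * c + m) + 1 := by ring
    omega
  have hr : ∀ i < m + 1, (r (i : ZMod n) : DihedralGroup n) ∈ intervalFactor n m := fun i hi =>
    r_mem_dihedralSet.2 (Finset.mem_image_of_mem _ (Finset.mem_range.2 hi))
  have hsr : ∀ i < m, (sr (i : ZMod n) : DihedralGroup n) ∈ intervalFactor n m := fun i hi =>
    sr_mem_dihedralSet.2 (Finset.mem_image_of_mem _ (Finset.mem_range.2 hi))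
  have hr' : ∀ j < c, (r ((m + 1 + (2 * m + 1) * j : ℕ) : ZMod n) : DihedralGroup n) ∈
      intervalCofactor n m c := fun j hj =>
    r_mem_dihedralSet.2 (Finset.mem_image_of_mem
      (fun j => ((m + 1 + (2 * m + 1) * j : ℕ) : ZMod n)) (Finset.mem_range.2 hj))
  have hsr' : ∀ j < c + 1, (sr ((m + (2 * m + 1) * j : ℕ) : ZMod n) : DihedralGroup n) ∈
      intervalCofactor n m c := fun j hj =>
    sr_mem_dihedralSet.2 (Finset.mem_image_of_mem
      (fun j => ((m + (2 * m + 1) * j : ℕ) : ZMod n)) (Finset.mem_range.2 hj))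
  intro g hg
  rw [Finset.mem_mul]
  rcases g with i | i
  · obtain ⟨v, hv⟩ : ∃ v, i.val = v + 1 := by
      refine Nat.exists_eq_succ_of_ne_zero fun h0 => ?_
      rw [ZMod.val_eq_zero] at h0
      simp [h0] at hg
    have hvn := ZMod.val_lt i
    rw [hv] at hvn
    have hi : i = ((v + 1 : ℕ) : ZMod n) := by rw [← hv, ZMod.natCast_zmod_val]
    have hdm := Nat.div_add_mod v (2 * m + 1)
    have hs := Nat.mod_lt v (show 0 < 2 * m + 1 by omega)
    set q := v / (2 * m + 1)
    set s := v % (2 * m + 1)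
    by_cases hsm : s < m
    · have hq : q < c + 1 := by
        by_contra hq
        have := Nat.mul_le_mul_left (2 * m + 1) (show c + 1 ≤ q by omega)
        rw [mul_add] at this
        omega
      refine ⟨_, hsr (m - 1 - s) (by omega), _, hsr' q hq, ?_⟩
      rw [sr_mul_sr, hi, sub_eq_iff_eq_add.2]
      rw [← Nat.cast_add]
      congr 1
      omega
    · have hq : q < c := by
        by_contra hq
        have := Nat.mul_le_mul_left (2 * m + 1) (show c ≤ q by omega)
        omega
      refine ⟨_, hr (s - m) (by omega), _, hr' q hq, ?_⟩
      rw [r_mul_r, hi, ← Nat.cast_add]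
      congr 2
      omega
  · have hvn := ZMod.val_lt i
    have hi : i = ((i.val : ℕ) : ZMod n) := by rw [ZMod.natCast_zmod_val]
    set v := i.val
    have hdm := Nat.div_add_mod v (2 * m + 1)
    have hs := Nat.mod_lt v (show 0 < 2 * m + 1 by omega)
    set q := v / (2 * m + 1)
    set s := v % (2 * m + 1)
    by_cases hsm : s < m + 1
    · have hq : q < c + 1 := by
        by_contra hq
        have := Nat.mul_le_mul_left (2 * m + 1) (show c + 1 ≤ q by omega)
        rw [mul_add] at this
        omega
      refine ⟨_, hr (m - s) (by omega), _, hsr' q hq, ?_⟩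
      rw [r_mul_sr, hi, sub_eq_iff_eq_add.2]
      rw [← Nat.cast_add]
      congr 1
      omega
    · have hq : q < c := by
        by_contra hq
        have := Nat.mul_le_mul_left (2 * m + 1) (show c ≤ q by omega)
        omega
      refine ⟨_, hsr (s - m - 1) (by omega), _, hr' q hq, ?_⟩
      rw [sr_mul_r, hi, ← Nat.cast_add]
      congr 2
      omega

/-- At most `(2 * m + 1) * (2 * c + 1) = |G| - 1` products cover `G - 1`, so every inequality
between cardinalities is an equality. -/
theorem isNearFactorization_intervalFactor [NeZero n] {m c : ℕ}
    (h : (2 * m + 1) * (2 * c + 1) = 2 * n - 1) :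
    IsNearFactorization (2 * m + 1) (2 * c + 1) (intervalFactor n m) (intervalCofactor n m c) := by
  have hsub := subset_intervalFactor_mul h
  have hcard : (Finset.univ \ {1} : Finset (DihedralGroup n)).card = 2 * n - 1 := by
    rw [Finset.card_sdiff_of_subset (Finset.subset_univ _), Finset.card_univ, DihedralGroup.card,
      Finset.card_singleton]
  have h1 : (intervalFactor n m).card ≤ 2 * m + 1 := by
    rw [intervalFactor, card_dihedralSet]
    have h1 := Finset.card_image_le (s := Finset.range (m + 1)) (f := ((↑) : ℕ → ZMod n))
    have h2 := Finset.card_image_le (s := Finset.range m) (f := ((↑) : ℕ → ZMod n))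
    rw [Finset.card_range] at h1 h2
    omega
  have h2 : (intervalCofactor n m c).card ≤ 2 * c + 1 := by
    rw [intervalCofactor, card_dihedralSet]
    have h1 := Finset.card_image_le (s := Finset.range c)
      (f := fun j => ((m + 1 + (2 * m + 1) * j : ℕ) : ZMod n))
    have h2 := Finset.card_image_le (s := Finset.range (c + 1))
      (f := fun j => ((m + (2 * m + 1) * j : ℕ) : ZMod n))
    rw [Finset.card_range] at h1 h2
    omega
  have h3 := Finset.card_le_card hsub
  have h4 := Finset.card_mul_le (s := intervalFactor n m) (t := intervalCofactor n m c)
  have h5 : (intervalFactor n m).card * (intervalCofactor n m c).card ≤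
      (2 * m + 1) * (2 * c + 1) := Nat.mul_le_mul h1 h2
  have h6 : (intervalFactor n m).card = 2 * m + 1 := by
    by_contra hne
    have : (intervalFactor n m).card * (intervalCofactor n m c).card ≤
      (2 * m) * (2 * c + 1) := Nat.mul_le_mul (by omega) h2
    rw [add_mul] at h
    omega
  have h7 : (intervalCofactor n m c).card = 2 * c + 1 := by
    by_contra hne
    have : (intervalFactor n m).card * (intervalCofactor n m c).card ≤
      (2 * m + 1) * (2 * c) := Nat.mul_le_mul h1 (by omega)
    rw [mul_add] at h
    omega
  refine ⟨h6, h7, by rw [h6, h7, h, DihedralGroup.card], ?_⟩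
  exact (Finset.eq_of_subset_of_card_le hsub (by omega)).symm

end NearFactorization

namespace NearFactorization

open DihedralGroup

/-! ### Normal forms of subsets of cyclic groups -/

variable {n : ℕ}

/-- The number whose binary digits are given by the set `S`. -/
def maskOf (S : Finset (ZMod n)) : ℕ := ∑ y ∈ S, 2 ^ y.val

/-- `S` contains `0`, and its mask is least among the images of `S` that contain `0` under
the affine maps with linear part in `H`. -/
structure IsNormal (H : Subgroup (ZMod n)ˣ) (S : Finset (ZMod n)) : Prop where
  zero_mem : 0 ∈ S
  le : ∀ v ∈ H, ∀ z ∈ S, maskOf S ≤ maskOf (S.image fun y => (v : ZMod n) * (y - z))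

/-- Choose the image of least mask; the affine images of an image are again images of `S`. -/
theorem exists_isNormal (H : Subgroup (ZMod n)ˣ) {S : Finset (ZMod n)} (hS : S.Nonempty) :
    ∃ u ∈ H, ∃ x, IsNormal H (S.image fun y => (u : ZMod n) * (y - x)) := by
  classical
  let p : ℕ → Prop := fun M => ∃ u ∈ H, ∃ x ∈ S, maskOf (S.image fun y => (u : ZMod n) * (y - x)) = M
  have hp : ∃ M, p M := by
    obtain ⟨x, hx⟩ := hS
    exact ⟨_, 1, H.one_mem, x, hx, rfl⟩
  obtain ⟨u, hu, x, hx, hM⟩ := Nat.find_spec hp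
  refine ⟨u, hu, x, Finset.mem_image.2 ⟨x, hx, by simp⟩, fun v hv z hz => ?_⟩
  obtain ⟨w, hw, rfl⟩ := Finset.mem_image.1 hz
  rw [hM]
  refine Nat.find_min' hp ⟨v * u, H.mul_mem hv hu, w, hw, ?_⟩
  rw [Finset.image_image]
  congr 1
  refine Finset.image_congr fun y _ => ?_
  simp only [Function.comp, Units.val_mul]
  ring

theorem card_image_affine (u : (ZMod n)ˣ) (x : ZMod n) (S : Finset (ZMod n)) :
    (S.image fun y => (u : ZMod n) * (y - x)).card = S.card :=
  Finset.card_image_of_injective _ fun a b h => by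
    simpa using u.isUnit.mul_left_cancel h

theorem maskOf_image_affine (u : (ZMod n)ˣ) (x : ZMod n) (S : Finset (ZMod n)) :
    maskOf (S.image fun y => (u : ZMod n) * (y - x)) =
      ∑ y ∈ S, 2 ^ ((u : ZMod n) * (y - x)).val := by
  rw [maskOf, Finset.sum_image]
  intro a _ b _ h
  simpa using u.isUnit.mul_left_cancel h

/-- The common multiplier is spent on `S`, so `T` is normalized by translations only: hence `⊤` and
`⊥`. For `m > 0` the set `T` is nonempty and can be moved to contain `0`. -/
theorem exists_factorEquiv_isNormal {k l m : ℕ} [NeZero n] {A B : Finset (DihedralGroup n)}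
    (h : IsNearFactorization k l A B) (hm : 0 < m) (hk : k = 2 * m + 1) :
    ∃ S T : Finset (ZMod n), FactorEquiv A (dihedralSet S T) ∧ S.card = m + 1 ∧ T.card = m ∧
      IsNormal ⊤ S ∧ IsNormal ⊥ T := by
  obtain ⟨S, T, hA, hS, hT⟩ : ∃ S T : Finset (ZMod n), FactorEquiv A (dihedralSet S T) ∧
      S.card = m + 1 ∧ T.card = m := by
    obtain ⟨S, T, rfl⟩ := exists_eq_dihedralSet A
    have h1 := card_sub_card h
    have h2 := h.1
    rw [card_dihedralSet] at h2
    rcases h1 with h1 | h1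
    · exact ⟨S, T, ⟨1, 1, by rw [Finset.singleton_one, mul_one]; ext; simp⟩, by omega, by omega⟩
    · have hinj : Function.Injective fun i : ZMod n => 0 - i := fun a b h => by simpa using h
      refine ⟨_, _, factorEquiv_dihedralSet_swap, ?_, ?_⟩
      · rw [Finset.card_image_of_injective _ hinj]; omega
      · rw [Finset.card_image_of_injective _ hinj]; omega
  obtain ⟨u, -, x, hx⟩ := exists_isNormal ⊤ (Finset.card_pos.1 (by omega : 0 < S.card))
  have hT' : (T.image fun y => (u : ZMod n) * (y - 0)).Nonempty :=
    (Finset.card_pos.1 (by omega : 0 < T.card)).image _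
  obtain ⟨v, hv, y, hy⟩ := exists_isNormal ⊥ hT'
  rw [Subgroup.mem_bot] at hv
  subst hv
  -- `T` is translated before it is scaled, so the shift `y` found after scaling is divided by `u`.
  refine ⟨_, _, hA.trans (factorEquiv_dihedralSet u x (↑u⁻¹ * y)), ?_, ?_, hx, ?_⟩
  · rw [card_image_affine, hS]
  · rw [card_image_affine, hT]
  · convert hy using 1
    rw [Finset.image_image]
    refine Finset.image_congr fun i _ => ?_
    simp [mul_sub]

/-! ### Indices of the elements of a dihedral group -/

/-- The index of `g` in the list `r 0, …, r (n - 1), sr 0, …, sr (n - 1)`. -/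
def index : DihedralGroup n → ℕ
  | r i => i.val
  | sr i => n + i.val

/-- The index of a product. -/
def mulIndex (n i j : ℕ) : ℕ :=
  cond (Nat.blt i n)
    (cond (Nat.blt j n) (Nat.mod (Nat.add i j) n)
      (Nat.add n (Nat.mod (Nat.sub (Nat.add j n) i) n)))
    (cond (Nat.blt j n) (Nat.add n (Nat.mod (Nat.add i j) n)) (Nat.mod (Nat.sub (Nat.add j n) i) n))

theorem mulIndex_eq (i j : ℕ) : mulIndex n i j =
    if i < n then (if j < n then (i + j) % n else n + (j + n - i) % n)
      else if j < n then n + (i + j) % n else (j + n - i) % n := by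
  have h : ∀ i, Nat.blt i n = decide (i < n) := fun i => by
    by_cases hi : i < n
    · rw [decide_eq_true hi]; exact Nat.ble_eq_true_of_le hi
    · rw [decide_eq_false hi]
      exact Bool.eq_false_iff.2 fun h' => hi (Nat.le_of_ble_eq_true h')
  rw [mulIndex, h, h]
  by_cases hi : i < n <;> by_cases hj : j < n <;> simp only [hi, hj, decide_true, decide_false,
    cond_true, cond_false, if_true, if_false] <;> rfl

section index

variable [NeZero n]

theorem mulIndex_lt (i j : ℕ) : mulIndex n i j < 2 * n := by
  have h : ∀ a, a % n < n := fun a => Nat.mod_lt _ (NeZero.pos n)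
  rw [mulIndex_eq]
  have h1 := h (i + j)
  have h2 := h (j + n - i)
  split_ifs <;> omega

theorem index_lt (g : DihedralGroup n) : index g < 2 * n := by
  rcases g with i | i <;> have := ZMod.val_lt i <;> simp only [index] <;> omega

theorem index_injective : Function.Injective (index : DihedralGroup n → ℕ) := by
  rintro (i | i) (j | j) h <;> have hi := ZMod.val_lt i <;> have hj := ZMod.val_lt j <;>
    simp only [index] at h
  · rw [ZMod.val_injective n h]
  · omega
  · omega
  · rw [ZMod.val_injective n (Nat.add_left_cancel h)]

theorem index_eq_zero {g : DihedralGroup n} : index g = 0 ↔ g = 1 := by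
  have h1 : index (1 : DihedralGroup n) = 0 := by
    rw [one_def]
    simp [index]
  rw [← h1, index_injective.eq_iff]

omit [NeZero n] in
theorem exists_index_eq {i : ℕ} (hi : i < 2 * n) : ∃ g : DihedralGroup n, index g = i := by
  by_cases h : i < n
  · exact ⟨r (i : ZMod n), by simp [index, ZMod.val_natCast, Nat.mod_eq_of_lt h]⟩
  · exact ⟨sr ((i - n : ℕ) : ZMod n), by
      simp only [index, ZMod.val_natCast, Nat.mod_eq_of_lt (show i - n < n by omega)]
      omega⟩

theorem val_sub_eq (i j : ZMod n) : (j - i).val = (j.val + n - i.val) % n := by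
  have h : j - i = ((j.val + n - i.val : ℕ) : ZMod n) := by
    rw [Nat.cast_sub (by have := ZMod.val_lt i; omega)]
    simp
  rw [h, ZMod.val_natCast]

theorem mulIndex_index (g h : DihedralGroup n) : mulIndex n (index g) (index h) = index (g * h) := by
  rcases g with i | i <;> rcases h with j | j <;> have hi := ZMod.val_lt i <;>
    have hj := ZMod.val_lt j
  · change mulIndex n i.val j.val = (i + j).val
    rw [mulIndex_eq, if_pos hi, if_pos hj, ZMod.val_add]
  · change mulIndex n i.val (n + j.val) = n + (j - i).val
    rw [mulIndex_eq, if_pos hi, if_neg (by omega), val_sub_eq,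
      show n + j.val + n - i.val = j.val + n - i.val + n by omega, Nat.add_mod_right]
  · change mulIndex n (n + i.val) j.val = n + (i + j).val
    rw [mulIndex_eq, if_neg (by omega), if_pos hj, ZMod.val_add,
      show n + i.val + j.val = i.val + j.val + n by omega, Nat.add_mod_right]
  · change mulIndex n (n + i.val) (n + j.val) = (j - i).val
    rw [mulIndex_eq, if_neg (by omega), if_neg (by omega), val_sub_eq,
      show n + j.val + n - (n + i.val) = j.val + n - i.val by omega]

end index

/-- The mask of two positions `i` and `2 * n + j`, with three bits for each position. -/
def pairBits (n i j : ℕ) : ℕ := Nat.lor (Nat.pow 8 i) (Nat.pow 8 (Nat.add (Nat.mul 2 n) j))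

/-- The mask of the products of two elements, in both orders. -/
def tile (n a b : ℕ) : ℕ := pairBits n (mulIndex n a b) (mulIndex n b a)

theorem testBit_eight_pow (i x : ℕ) : (8 ^ i).testBit x = true ↔ x = 3 * i := by
  rw [show 8 = 2 ^ 3 by norm_num, ← pow_mul, Nat.testBit_two_pow]
  simp [eq_comm]

theorem testBit_pairBits (i j x : ℕ) :
    (pairBits n i j).testBit x = true ↔ x = 3 * i ∨ x = 3 * (2 * n + j) := by
  change (8 ^ i ||| 8 ^ (2 * n + j)).testBit x = true ↔ _
  rw [Nat.testBit_lor, Bool.or_eq_true, testBit_eight_pow, testBit_eight_pow]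

theorem pairBits_lt {i j : ℕ} (hi : i < 2 * n) (hj : j < 2 * n) :
    pairBits n i j < 2 ^ (12 * n) := by
  apply Nat.lt_pow_two_of_testBit
  intro x hx
  rw [← Bool.not_eq_true, testBit_pairBits]
  omega

theorem testBit_tile [NeZero n] (g h : DihedralGroup n) (x : ℕ) :
    (tile n (index g) (index h)).testBit x = true ↔
      x = 3 * index (g * h) ∨ x = 3 * (2 * n + index (h * g)) := by
  rw [tile, testBit_pairBits, mulIndex_index, mulIndex_index]

theorem tile_lt [NeZero n] (a b : ℕ) : tile n a b < 2 ^ (12 * n) :=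
  pairBits_lt (mulIndex_lt _ _) (mulIndex_lt _ _)

/-- `t` gives the masks of the products of the elements of `A` with the group elements. -/
def IsTiling [NeZero n] (A : Finset (DihedralGroup n)) (t : ℕ → ℕ) : Prop :=
  (∀ i, t i < 2 ^ (12 * n)) ∧ ∀ b : DihedralGroup n, ∀ x, (t (index b)).testBit x = true ↔
    ∃ a ∈ A, x = 3 * index (a * b) ∨ x = 3 * (2 * n + index (b * a))

section tiling

variable [NeZero n] {A A' B : Finset (DihedralGroup n)} {t t' : ℕ → ℕ} {k l : ℕ}

/-- Lane `0` belongs to the identity, so it records `A` itself. -/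
theorem IsTiling.mem_iff (ht : IsTiling A t) (a : DihedralGroup n) :
    a ∈ A ↔ (t 0).testBit (3 * index a) = true := by
  have h1 : index (1 : DihedralGroup n) = 0 := index_eq_zero.2 rfl
  rw [← h1, ht.2]
  have ha := index_lt a
  constructor
  · exact fun h => ⟨a, h, by simp⟩
  · rintro ⟨a', ha', h | h⟩
    · rw [mul_one] at h
      rwa [index_injective (Nat.eq_of_mul_eq_mul_left three_pos h)]
    · omega

theorem IsTiling.eq_of_eq (ht : IsTiling A t) (ht' : IsTiling A' t') (h : t 0 = t' 0) :
    A = A' := by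
  ext a
  rw [ht.mem_iff, ht'.mem_iff, h]

/-- A mate of `A` gives an exact cover of the positions of the elements other than `1`. -/
theorem IsTiling.isCover (ht : IsTiling A t) (h : IsNearFactorization k l A B) (hA : A.Nonempty)
    {U : ℕ} (hU : ∀ x, U.testBit x = true ↔ ∃ i < 4 * n, i % (2 * n) ≠ 0 ∧ x = 3 * i) :
    IsCover (2 * n) (fun i => if t i &&& pairBits n 0 0 = 0 then t i else 0) U
      (B.image index) := by
  -- The products `b * a` fill the second block of `2 * n` positions, a constraint that commutation
  -- gives for free.
  have h' := isNearFactorization_swap h hA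
  have hne : ∀ a ∈ A, ∀ b ∈ B, a * b ≠ 1 := by
    intro a ha b hb hab
    have : a * b ∈ A * B := Finset.mul_mem_mul ha hb
    rw [h.2.2.2, hab] at this
    simp at this
  have hne' : ∀ a ∈ A, ∀ b ∈ B, b * a ≠ 1 := fun a ha b hb hab =>
    hne a ha b hb (mul_eq_one_comm.1 hab)
  refine IsCover.congr (t := t) ⟨?_, ?_, ?_⟩ ?_
  · intro i hi
    obtain ⟨b, -, rfl⟩ := Finset.mem_image.1 hi
    exact index_lt b
  · intro i hi j hj hij
    obtain ⟨b, hb, rfl⟩ := Finset.mem_image.1 hi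
    obtain ⟨b', hb', rfl⟩ := Finset.mem_image.1 hj
    by_contra hne
    obtain ⟨x, h1, h2⟩ := land_ne_zero_iff.1 hne
    obtain ⟨a, ha, h1⟩ := (ht.2 _ _).1 h1
    obtain ⟨a', ha', h2⟩ := (ht.2 _ _).1 h2
    apply hij
    have i1 := index_lt (a * b)
    have i2 := index_lt (a' * b')
    rcases h1 with h1 | h1 <;> rcases h2 with h2 | h2
    · rw [(mul_inj_of_isNearFactorization h ha ha' hb hb' (index_injective (by omega))).2]
    · omega
    · omega
    · rw [(mul_inj_of_isNearFactorization h' hb hb' ha ha' (index_injective (by omega))).1]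
  · intro x
    rw [hU]
    constructor
    · rintro ⟨i, hi, hi0, rfl⟩
      by_cases hin : i < 2 * n
      · obtain ⟨g, rfl⟩ := exists_index_eq hin
        rw [Nat.mod_eq_of_lt hin, Ne, index_eq_zero] at hi0
        have hg : g ∈ A * B := by rw [h.2.2.2]; simpa using hi0
        obtain ⟨a, ha, b, hb, rfl⟩ := Finset.mem_mul.1 hg
        exact ⟨_, Finset.mem_image_of_mem _ hb, (ht.2 _ _).2 ⟨a, ha, Or.inl rfl⟩⟩
      · obtain ⟨g, hg⟩ := exists_index_eq (n := n) (i := i - 2 * n) (by omega)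
        rw [Nat.mod_eq_sub_mod (by omega), Nat.mod_eq_of_lt (by omega), ← hg, Ne,
          index_eq_zero] at hi0
        have hg' : g ∈ B * A := by rw [h'.2.2.2]; simpa using hi0
        obtain ⟨b, hb, a, ha, rfl⟩ := Finset.mem_mul.1 hg'
        exact ⟨_, Finset.mem_image_of_mem _ hb, (ht.2 _ _).2 ⟨a, ha, Or.inr (by omega)⟩⟩
    · rintro ⟨i, hi, hx⟩
      obtain ⟨b, hb, rfl⟩ := Finset.mem_image.1 hi
      obtain ⟨a, ha, hx | hx⟩ := (ht.2 _ _).1 hx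
      · have := index_lt (a * b)
        refine ⟨_, by omega, ?_, hx⟩
        rw [Nat.mod_eq_of_lt this, Ne, index_eq_zero]
        exact hne a ha b hb
      · have := index_lt (b * a)
        refine ⟨_, by omega, ?_, hx⟩
        rw [Nat.add_mod_left, Nat.mod_eq_of_lt this, Ne, index_eq_zero]
        exact hne' a ha b hb
  -- No element of a mate yields the product `1`, so its lane survives the removal of the lanes
  -- meeting an identity position.
  · intro i hi
    obtain ⟨b, hb, rfl⟩ := Finset.mem_image.1 hi
    rw [if_pos]
    by_contra hne0
    obtain ⟨x, h1, h2⟩ := land_ne_zero_iff.1 hne0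
    rw [testBit_pairBits] at h2
    obtain ⟨a, ha, h1⟩ := (ht.2 _ _).1 h1
    have i1 := index_lt (a * b)
    have j1 : index (a * b) ≠ 0 := fun h0 => hne a ha b hb (index_eq_zero.1 h0)
    have j2 : index (b * a) ≠ 0 := fun h0 => hne' a ha b hb (index_eq_zero.1 h0)
    omega

end tiling

end NearFactorization

namespace NearFactorization

/-! ### Packing and reading families -/

/-- `k (packed W m f)`, arranged so that the family is packed first. -/
def packing (W : ℕ) (f : ℕ → ℕ) (m : ℕ) (k : ℕ → Bool) : Bool :=
  Nat.rec (fun acc => k acc)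
    (fun i ih acc => force (Nat.add acc (Nat.mul (f i) (Nat.pow W i))) ih) m 0

theorem packing_eq (W : ℕ) (f : ℕ → ℕ) (m : ℕ) (k : ℕ → Bool) :
    packing W f m k = k (packed W m f) := by
  have key : ∀ acc, (Nat.rec (fun acc => k acc)
      (fun i ih acc => force (Nat.add acc (Nat.mul (f i) (Nat.pow W i))) ih) m : ℕ → Bool) acc =
        k (acc + packed W m f) := by
    induction m with
    | zero => intro acc; rw [packed_zero]; rfl
    | succ m ih =>
      intro acc
      change force _ _ = _
      rw [force_eq, ih, packed, packed, Finset.sum_range_succ, add_comm (Finset.sum _ _),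
        ← add_assoc]
      rfl
  rw [packing, key, zero_add]

/-- Evaluates `packed W m f`. -/
def packSum (W : ℕ) (f : ℕ → ℕ) (m : ℕ) : ℕ :=
  Nat.rec 0 (fun i acc => Nat.add acc (Nat.mul (f i) (Nat.pow W i))) m

theorem packSum_eq (W : ℕ) (f : ℕ → ℕ) (m : ℕ) : packSum W f m = packed W m f := by
  induction m with
  | zero => rw [packed_zero]; rfl
  | succ m ih =>
    change packSum W f m + f m * W ^ m = _
    rw [ih, packed, packed, Finset.sum_range_succ]

theorem testBit_packed {w m : ℕ} (hw : 0 < w) {e : ℕ → ℕ} (he : ∀ i, e i ≤ 1) (x : ℕ) :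
    (packed (2 ^ w) m e).testBit x = true ↔ ∃ i < m, e i = 1 ∧ x = w * i := by
  induction m generalizing e x with
  | zero => simp [packed_zero]
  | succ m ih =>
    have h0 : e 0 < 2 ^ w := (he 0).trans_lt (Nat.one_lt_two_pow hw.ne')
    have h1 : (e 0).testBit x = true ↔ e 0 = 1 ∧ x = 0 := by
      have := he 0
      rcases Nat.eq_zero_or_pos (e 0) with h | h
      · simp [h]
      · rw [show e 0 = 2 ^ 0 by rw [pow_zero]; omega, Nat.testBit_two_pow]
        simp [eq_comm]
    rw [packed_succ, testBit_add_two_pow_mul h0, Nat.exists_lt_succ_left]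
    split_ifs with hx
    · rw [h1]
      constructor
      · exact fun h => Or.inl ⟨h.1, h.2⟩
      · rintro (h | ⟨i, -, -, h⟩)
        · exact h
        · rw [mul_add] at h
          omega
    · rw [ih fun i => he _]
      constructor
      · rintro ⟨i, hi, h, h'⟩
        exact Or.inr ⟨i, hi, h, by rw [mul_add]; omega⟩
      · rintro (⟨-, h⟩ | ⟨i, hi, h, h'⟩)
        · omega
        · exact ⟨i, hi, h, by rw [mul_add] at h'; omega⟩

/-- The tiles of the elements of index `c + y`, `y ∈ l`, joined. -/
def tiles (n c : ℕ) (l : List ℕ) (b : ℕ) : ℕ := l.foldr (fun y t => tile n (c + y) b ||| t) 0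

/-- For `B` packing a family in base `V`, this joins its members of index `c + y`, `y ∈ l`. -/
def lookup (B V c : ℕ) (l : List ℕ) : ℕ :=
  List.rec 0 (fun y _ ih => Nat.lor (Nat.mod (Nat.div B (Nat.pow V (Nat.add c y))) V) ih) l

section tiles

variable {n : ℕ}

theorem tiles_cons (c y : ℕ) (l : List ℕ) (b : ℕ) :
    tiles n c (y :: l) b = tile n (c + y) b ||| tiles n c l b := rfl

theorem testBit_tiles (c : ℕ) (l : List ℕ) (b x : ℕ) :
    (tiles n c l b).testBit x = true ↔ ∃ y ∈ l, (tile n (c + y) b).testBit x = true := by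
  induction l with
  | nil => simp [tiles]
  | cons y l ih => rw [tiles_cons, Nat.testBit_lor, Bool.or_eq_true, ih]; simp

variable [NeZero n]

theorem tiles_lt (c : ℕ) (l : List ℕ) (b : ℕ) : tiles n c l b < 2 ^ (12 * n) := by
  induction l with
  | nil => exact Nat.two_pow_pos _
  | cons y l ih => exact Nat.or_lt_two_pow (tile_lt _ _) ih

/-- The table has two levels: a digit in the large base is the whole row of tiles of one element,
and joining rows joins all lanes at once. -/
theorem lookup_eq {c : ℕ} {l : List ℕ} (hl : ∀ y ∈ l, c + y < 2 * n) :
    lookup (packed ((2 ^ (12 * n + 1)) ^ (2 * n)) (2 * n) fun a =>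
        packed (2 ^ (12 * n + 1)) (2 * n) (tile n a)) ((2 ^ (12 * n + 1)) ^ (2 * n)) c l =
      packed (2 ^ (12 * n + 1)) (2 * n) (tiles n c l) := by
  have hW : 2 ^ (12 * n) < 2 ^ (12 * n + 1) := Nat.pow_lt_pow_right (by norm_num) (Nat.lt_succ_self _)
  induction l with
  | nil =>
    change 0 = _
    exact (Finset.sum_eq_zero fun i _ => by simp [tiles]).symm
  | cons y l ih =>
    have h1 := packed_div_mod (W := (2 ^ (12 * n + 1)) ^ (2 * n)) (m := 2 * n)
      (f := fun a => packed (2 ^ (12 * n + 1)) (2 * n) (tile n a)) (by positivity)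
      (fun i => packed_lt fun j => (tile_lt _ _).trans hW) (hl y (by simp))
    have h2 := ih fun z hz => hl z (List.mem_cons_of_mem _ hz)
    change _ / _ ^ (c + y) % _ ||| lookup _ _ c l = _
    rw [h1, h2, packed_lor (fun i => (tile_lt _ _).trans hW) fun i => (tiles_lt _ _ _).trans hW]
    rfl

theorem isTiling_tiles {S T : Finset (ZMod n)} {l l' : List ℕ}
    (hl : ∀ y, y ∈ l ↔ ∃ i ∈ S, i.val = y) (hl' : ∀ y, y ∈ l' ↔ ∃ i ∈ T, i.val = y) :
    IsTiling (dihedralSet S T) fun b => tiles n 0 l b ||| tiles n n l' b := by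
  refine ⟨fun b => Nat.or_lt_two_pow (tiles_lt _ _ _) (tiles_lt _ _ _), fun b x => ?_⟩
  rw [Nat.testBit_lor, Bool.or_eq_true, testBit_tiles, testBit_tiles]
  constructor
  · rintro (⟨y, hy, hx⟩ | ⟨y, hy, hx⟩)
    · obtain ⟨i, hi, rfl⟩ := (hl y).1 hy
      rw [zero_add] at hx
      exact ⟨_, r_mem_dihedralSet.2 hi, (testBit_tile (DihedralGroup.r i) b x).1 hx⟩
    · obtain ⟨i, hi, rfl⟩ := (hl' y).1 hy
      exact ⟨_, sr_mem_dihedralSet.2 hi, (testBit_tile (DihedralGroup.sr i) b x).1 hx⟩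
  · rintro ⟨i | i, hi, hx⟩
    · refine Or.inl ⟨i.val, (hl _).2 ⟨i, r_mem_dihedralSet.1 hi, rfl⟩, ?_⟩
      rw [zero_add]
      exact (testBit_tile (DihedralGroup.r i) b x).2 hx
    · exact Or.inr ⟨i.val, (hl' _).2 ⟨i, sr_mem_dihedralSet.1 hi, rfl⟩,
        (testBit_tile (DihedralGroup.sr i) b x).2 hx⟩

end tiles

/-! ### Tests on lists of residues -/

/-- `p x` for all `x ∈ l`. -/
def allList (p : ℕ → Bool) (l : List ℕ) : Bool := List.rec true (fun x _ ih => cond (p x) ih false) l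

theorem allList_eq_true {p : ℕ → Bool} {l : List ℕ} :
    allList p l = true ↔ ∀ x ∈ l, p x = true := by
  induction l with
  | nil => simp [allList]
  | cons x l ih =>
    change cond (p x) (allList p l) false = true ↔ _
    rw [List.forall_mem_cons, ← ih]
    cases p x <;> simp

/-- The sum of `g y` for `y ∈ l`. -/
def sumList (g : ℕ → ℕ) (l : List ℕ) : ℕ := List.rec 0 (fun y _ ih => Nat.add (g y) ih) l

/-- The mask of the residues `u * (y - x)` modulo `n`, for `y ∈ l`. -/
def shiftMask (n u x : ℕ) (l : List ℕ) : ℕ :=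
  sumList (fun y => Nat.pow 2 (Nat.mod (Nat.mul u (Nat.sub (Nat.add y n) x)) n)) l

/-- Whether the mask of `l` is least among those of its images that contain `0` under the affine
maps with linear part in `us`. -/
def isMin (n : ℕ) (us l : List ℕ) : Bool :=
  force (shiftMask n 1 0 l) fun M =>
    allList (fun u => allList (fun x => Nat.ble M (shiftMask n u x l)) l) us

/-- Whether the numbers of odd and of even residues in `l` differ by at most `1`, for `n` even;
here `s` is the length of `l`. -/
def parityTest (n s : ℕ) (l : List ℕ) : Bool :=
  ifZero (Nat.mod n 2) (force (Nat.mul 2 (sumList (fun y => Nat.mod y 2) l)) fun c =>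
    cond (Nat.ble c (Nat.succ s)) (Nat.ble s (Nat.succ c)) false) true

section lists

variable {n : ℕ} [NeZero n] {S : Finset (ZMod n)} {l : List ℕ}

omit [NeZero n] in
theorem mem_iff_of_coe_eq (hl : (l : Multiset ℕ) = (S.image ZMod.val).val) (y : ℕ) :
    y ∈ l ↔ ∃ i ∈ S, i.val = y := by
  rw [← Multiset.mem_coe, hl, Finset.mem_val, Finset.mem_image]

theorem sumList_eq (g : ℕ → ℕ) (hl : (l : Multiset ℕ) = (S.image ZMod.val).val) :
    sumList g l = ∑ i ∈ S, g i.val := by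
  have h1 : sumList g l = (l.map g).sum := by
    clear hl
    induction l with
    | nil => rfl
    | cons y l ih =>
      change g y + sumList g l = _
      rw [ih, List.map_cons, List.sum_cons]
  have h2 := Finset.sum_image (s := S) (g := ZMod.val) (f := g)
    (ZMod.val_injective n).injOn
  rw [h1, ← h2, Finset.sum_eq_multiset_sum, ← hl, Multiset.map_coe, Multiset.sum_coe]

theorem shiftMask_eq (hl : (l : Multiset ℕ) = (S.image ZMod.val).val) (u : (ZMod n)ˣ) {a : ℕ}
    (ha : (a : ZMod n) = u) (x : ZMod n) :
    shiftMask n a x.val l = maskOf (S.image fun y => (u : ZMod n) * (y - x)) := by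
  rw [maskOf_image_affine, shiftMask, sumList_eq _ hl]
  refine Finset.sum_congr rfl fun y _ => ?_
  change 2 ^ (a * (y.val + n - x.val) % n) = _
  have h : (u : ZMod n) * (y - x) = ((a * (y.val + n - x.val) : ℕ) : ZMod n) := by
    rw [Nat.cast_mul, Nat.cast_sub (by have := ZMod.val_lt x; omega), ha]
    simp
  rw [h, ZMod.val_natCast]

theorem isMin_eq_true {H : Subgroup (ZMod n)ˣ} (hS : IsNormal H S)
    (hl : (l : Multiset ℕ) = (S.image ZMod.val).val) {us : List ℕ}
    (hus : ∀ a ∈ us, ∃ u ∈ H, (a : ZMod n) = (u : (ZMod n)ˣ)) : isMin n us l = true := by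
  have h0 : shiftMask n 1 0 l = maskOf S := by
    have := shiftMask_eq hl 1 (a := 1) (by simp) 0
    rw [ZMod.val_zero] at this
    simpa using this
  rw [isMin, force_eq, allList_eq_true]
  intro a ha
  rw [allList_eq_true]
  intro y hy
  obtain ⟨u, hu, hau⟩ := hus a ha
  obtain ⟨x, hx, rfl⟩ := (mem_iff_of_coe_eq hl y).1 hy
  rw [h0, shiftMask_eq hl u hau]
  exact Nat.ble_eq_true_of_le (hS.le u hu x hx)

theorem parityTest_eq_true (hl : (l : Multiset ℕ) = (S.image ZMod.val).val)
    (h : Even n → 2 * ∑ i ∈ S, i.val % 2 ≤ S.card + 1 ∧ S.card ≤ 2 * (∑ i ∈ S, i.val % 2) + 1) :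
    parityTest n S.card l = true := by
  rw [parityTest, ifZero_eq, force_eq, sumList_eq _ hl]
  split_ifs with hn
  · obtain ⟨h1, h2⟩ := h (Nat.even_iff.2 hn)
    have h1' := Nat.ble_eq_true_of_le h1
    have h2' := Nat.ble_eq_true_of_le h2
    change cond (Nat.ble (2 * ∑ i ∈ S, i.val % 2) (S.card + 1))
      (Nat.ble S.card (2 * (∑ i ∈ S, i.val % 2) + 1)) false = true
    rw [h1', h2']
    rfl
  · rfl

end lists

/-! ### Enumeration of subsets -/

section subsets

variable (P : List ℕ → Bool) (f : List ℕ → ℕ)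

/-- `f cur` put in front of `out` if it passes the test `P`. -/
def collect (cur : List ℕ) (k : List ℕ → Bool) (out : List ℕ) : Bool :=
  cond (P cur) (force (f cur) fun x => k (x :: out)) (k out)

/-- `k` applied to `out` with the values of `f` added for the lists that consist of `cur` and
`s` of the numbers `1, …, m` and pass the test `P`. -/
def collectSubsets (m : ℕ) : ℕ → List ℕ → (List ℕ → Bool) → List ℕ → Bool :=
  Nat.rec (fun s cur k out => ifZero s (collect P f cur k out) (k out))
    (fun m ih s cur k out => Nat.rec (collect P f cur k out)
      (fun s' _ => ih s cur (ih s' (Nat.succ m :: cur) k) out) s) m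

variable {P f}

theorem exists_of_collect {cur : List ℕ} {k : List ℕ → Bool} {out : List ℕ}
    (h : collect P f cur k out = true) :
    ∃ out', k out' = true ∧ out ⊆ out' ∧ (P cur = true → f cur ∈ out') := by
  rw [collect, force_eq] at h
  cases hP : P cur with
  | true =>
    rw [hP] at h
    exact ⟨_, h, List.subset_cons_self _ _, fun _ => List.mem_cons_self⟩
  | false =>
    rw [hP] at h
    exact ⟨_, h, List.Subset.refl _, fun h => by simp at h⟩

/-- The subsets without `m + 1` are collected first, and their continuation collects those with it.
So success means that the final continuation accepts a list holding the results for all subsets. -/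
theorem exists_of_collectSubsets (m : ℕ) :
    ∀ (s : ℕ) (cur : List ℕ) (k : List ℕ → Bool) (out : List ℕ),
      collectSubsets P f m s cur k out = true →
      ∃ out', k out' = true ∧ out ⊆ out' ∧ ∀ S ⊆ Finset.Icc 1 m, S.card = s →
        ∃ l : List ℕ, (l : Multiset ℕ) = S.val ∧ (P (l ++ cur) = true → f (l ++ cur) ∈ out') := by
  induction m with
  | zero =>
    intro s cur k out h
    change ifZero s (collect P f cur k out) (k out) = true at h
    rw [ifZero_eq] at h
    split_ifs at h with hs
    · obtain ⟨out', h1, h2, h3⟩ := exists_of_collect h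
      refine ⟨out', h1, h2, fun S _ hS => ⟨[], ?_, h3⟩⟩
      rw [hs, Finset.card_eq_zero] at hS
      rw [hS]
      rfl
    · refine ⟨out, h, List.Subset.refl _, fun S hS hc => ?_⟩
      rw [Finset.Icc_eq_empty (by norm_num), Finset.subset_empty] at hS
      rw [hS, Finset.card_empty] at hc
      exact absurd hc.symm hs
  | succ m ih =>
    intro s cur k out h
    cases s with
    | zero =>
      obtain ⟨out', h1, h2, h3⟩ := exists_of_collect (P := P) (f := f) h
      refine ⟨out', h1, h2, fun S _ hS => ⟨[], ?_, h3⟩⟩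
      rw [Finset.card_eq_zero] at hS
      rw [hS]
      rfl
    | succ s =>
      obtain ⟨out₁, h1, h2, h3⟩ := ih (s + 1) cur _ _ h
      obtain ⟨out₂, h1', h2', h3'⟩ := ih s (Nat.succ m :: cur) _ _ h1
      refine ⟨out₂, h1', List.Subset.trans h2 h2', fun S hS hc => ?_⟩
      by_cases hm : m + 1 ∈ S
      · obtain ⟨l, hl, hl'⟩ := h3' (S.erase (m + 1)) (fun x hx => by
          have h4 := Finset.mem_erase.1 hx
          have h5 := Finset.mem_Icc.1 (hS h4.2)
          rw [Finset.mem_Icc]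
          omega) (by rw [Finset.card_erase_of_mem hm, hc]; rfl)
        refine ⟨l ++ [m + 1], ?_, by simpa using hl'⟩
        rw [← Multiset.coe_add, hl, Multiset.coe_singleton, add_comm, Multiset.singleton_add,
          Finset.erase_val, Multiset.cons_erase hm]
      · obtain ⟨l, hl, hl'⟩ := h3 S (fun x hx => by
          have h5 := Finset.mem_Icc.1 (hS hx)
          have h6 : x ≠ m + 1 := ne_of_mem_of_not_mem hx hm
          rw [Finset.mem_Icc]
          omega) hc
        exact ⟨l, hl, fun hP => h2' (hl' hP)⟩

theorem exists_of_collectSubsets_zmod {n : ℕ} [NeZero n] {s : ℕ} {k : List ℕ → Bool}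
    (h : collectSubsets P f (Nat.sub n 1) s [0] k [] = true) :
    ∃ out, k out = true ∧ ∀ S : Finset (ZMod n), 0 ∈ S → S.card = s + 1 →
      ∃ l : List ℕ, (l : Multiset ℕ) = (S.image ZMod.val).val ∧ (P l = true → f l ∈ out) := by
  obtain ⟨out, h1, -, h3⟩ := exists_of_collectSubsets _ _ _ _ _ h
  refine ⟨out, h1, fun S h0 hS => ?_⟩
  have h0' : 0 ∈ S.image ZMod.val := Finset.mem_image.2 ⟨0, h0, ZMod.val_zero⟩
  obtain ⟨l, hl, hl'⟩ := h3 ((S.image ZMod.val).erase 0) (fun x hx => by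
      obtain ⟨hx0, hx⟩ := Finset.mem_erase.1 hx
      obtain ⟨i, -, rfl⟩ := Finset.mem_image.1 hx
      have := ZMod.val_lt i
      rw [Finset.mem_Icc]
      change _ ∧ _ ≤ n - 1
      omega) (by
      rw [Finset.card_erase_of_mem h0', Finset.card_image_of_injective _ (ZMod.val_injective n), hS]
      rfl)
  refine ⟨l ++ [0], ?_, hl'⟩
  rw [← Multiset.coe_add, hl, Multiset.coe_singleton, add_comm, Multiset.singleton_add,
    Finset.erase_val, Multiset.cons_erase h0']

end subsets

/-! ### The complete search -/

/-- Whether the factor with lanes `F₀ ||| F₁` either is the one with lanes `T₀` or has no mate. -/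
def noMate (W H o fuel U t T₀ F₀ F₁ : ℕ) : Bool :=
  force (Nat.lor F₀ F₁) fun T =>
    cond (Nat.beq T T₀) true (force (clash H o T t) fun F => force (prune H o T F) fun T =>
      cond (cover W H o fuel U T) false true)

/-- The units modulo `n`. -/
def unitList (n : ℕ) : List ℕ := (List.range n).filter fun u => Nat.beq (Nat.gcd u n) 1

/-- The second part of `check`, where `B` packs the lanes of the group elements. -/
def checkWith (n m c W H V B o U : ℕ) : Bool :=
  force (Nat.lor (lookup B V 0 (List.range (Nat.succ m))) (lookup B V n (List.range m))) fun T₀ =>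
  -- The rotations are reduced by all units, the reflections below by translations only. Each list
  -- starts with `0`, so `m` and `m - 1` elements remain to be chosen.
  collectSubsets (fun l => cond (parityTest n (Nat.succ m) l) (isMin n (unitList n) l) false)
    (lookup B V 0) (Nat.sub n 1) m [0] (fun R₀ =>
  collectSubsets (fun l => cond (parityTest n m l) (isMin n [1] l) false)
    (lookup B V n) (Nat.sub n 1) (Nat.sub m 1) [0] (fun R₁ =>
  allList (fun F₀ => allList
    -- A mate has `2 * c + 1` elements; the fuel allows one level for each and one to spare.
    (noMate W H o (Nat.mul 2 (Nat.succ c)) U (pairBits n 0 0) T₀ F₀) R₁) R₀) []) []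

/-- A search through the normal forms of the `2 * m + 1`-subsets of a dihedral group; `true`
means that none but `intervalFactor` is a factor of a near-factorization. -/
def check (n m c : ℕ) : Bool :=
  force (Nat.pow 8 (Nat.mul 4 n)) fun H => force (Nat.mul 2 H) fun W =>
  force (Nat.pow W (Nat.mul 2 n)) fun V =>
  packing V (fun a => packSum W (tile n a) (Nat.mul 2 n)) (Nat.mul 2 n) fun B =>
  packing W (fun _ => 1) (Nat.mul 2 n) fun o =>
  packing 8 (fun i => ifZero (Nat.mod i (Nat.mul 2 n)) 0 1) (Nat.mul 4 n) fun U =>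
  checkWith n m c W H V B o U

section soundness

variable {n m c l : ℕ} [NeZero n]

omit [NeZero n] in
theorem check_eq : check n m c = checkWith n m c (2 ^ (12 * n + 1)) (2 ^ (12 * n))
    ((2 ^ (12 * n + 1)) ^ (2 * n))
    (packed ((2 ^ (12 * n + 1)) ^ (2 * n)) (2 * n) fun a =>
      packed (2 ^ (12 * n + 1)) (2 * n) (tile n a))
    (packed (2 ^ (12 * n + 1)) (2 * n) fun _ => 1)
    (packed (2 ^ 3) (4 * n) fun i => if i % (2 * n) = 0 then 0 else 1) := by
  have hH : Nat.pow 8 (Nat.mul 4 n) = 2 ^ (12 * n) := by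
    change 8 ^ (4 * n) = _
    rw [show 8 = 2 ^ 3 by norm_num, ← pow_mul]
    congr 1
    omega
  have hW : Nat.mul 2 (2 ^ (12 * n)) = 2 ^ (12 * n + 1) := (pow_succ' 2 _).symm
  simp only [check, force_eq, packing_eq, packSum_eq, ifZero_eq, hH, hW]
  rfl

/-- A tiling of a factor passes `noMate` only if it is the distinguished one. -/
theorem eq_of_noMate {A A₀ B : Finset (DihedralGroup n)} {t₀ f₀ f₁ : ℕ → ℕ} {k fuel U : ℕ}
    (h : IsNearFactorization k l A B) (hA : A.Nonempty) (ht₀ : IsTiling A₀ t₀)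
    (ht : IsTiling A fun b => f₀ b ||| f₁ b)
    (hf₀ : ∀ b, f₀ b < 2 ^ (12 * n)) (hf₁ : ∀ b, f₁ b < 2 ^ (12 * n))
    (hU : ∀ x, U.testBit x = true ↔ ∃ i < 4 * n, i % (2 * n) ≠ 0 ∧ x = 3 * i)
    (hm : noMate (2 ^ (12 * n + 1)) (2 ^ (12 * n)) (packed (2 ^ (12 * n + 1)) (2 * n) fun _ => 1)
      fuel U (pairBits n 0 0) (packed (2 ^ (12 * n + 1)) (2 * n) t₀)
      (packed (2 ^ (12 * n + 1)) (2 * n) f₀) (packed (2 ^ (12 * n + 1)) (2 * n) f₁) = true) :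
    A = A₀ := by
  have hW : 2 ^ (12 * n) < 2 ^ (12 * n + 1) := Nat.pow_lt_pow_right (by norm_num) (Nat.lt_succ_self _)
  have hn := NeZero.pos n
  have hlor : Nat.lor (packed (2 ^ (12 * n + 1)) (2 * n) f₀)
      (packed (2 ^ (12 * n + 1)) (2 * n) f₁) =
        packed (2 ^ (12 * n + 1)) (2 * n) fun b => f₀ b ||| f₁ b :=
    packed_lor (fun b => (hf₀ b).trans hW) fun b => (hf₁ b).trans hW
  -- The mate is a cover, so the search answers `true`, and `noMate` can hold only through the
  -- comparison with `T₀`.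
  rw [noMate, hlor, force_eq, force_eq, force_eq,
    prune_clash ht.1 (pairBits_lt (by omega) (by omega)),
    cover_eq_true _ _ _ _ (fun i => by
      split_ifs
      · exact ht.1 i
      · exact Nat.two_pow_pos _) (ht.isCover h hA hU)] at hm
  have hb : Nat.beq (packed (2 ^ (12 * n + 1)) (2 * n) fun b => f₀ b ||| f₁ b)
      (packed (2 ^ (12 * n + 1)) (2 * n) t₀) = true := by
    revert hm
    cases Nat.beq _ _ <;> simp
  have he := Nat.eq_of_beq_eq_true hb
  refine ht.eq_of_eq ht₀ ?_
  have h1 := packed_div_mod (q := 0) (m := 2 * n) (by positivity)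
    (fun i => (ht.1 i).trans hW) (by omega)
  have h2 := packed_div_mod (q := 0) (m := 2 * n) (by positivity)
    (fun i => (ht₀.1 i).trans hW) (by omega)
  rw [← h1, ← h2, he]

omit [NeZero n] in
theorem exists_unit_of_mem_unitList {a : ℕ} (ha : a ∈ unitList n) :
    ∃ u ∈ (⊤ : Subgroup (ZMod n)ˣ), (a : ZMod n) = (u : (ZMod n)ˣ) := by
  have h := Nat.eq_of_beq_eq_true (List.mem_filter.1 ha).2
  exact ⟨ZMod.unitOfCoprime a h, Subgroup.mem_top _, (ZMod.coe_unitOfCoprime a h).symm⟩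

omit [NeZero n] in
theorem mem_range_iff_exists_val {m : ℕ} (hm : m ≤ n) (y : ℕ) :
    y ∈ List.range m ↔ ∃ i ∈ (Finset.range m).image ((↑) : ℕ → ZMod n), i.val = y := by
  rw [List.mem_range]
  constructor
  · exact fun hy => ⟨_, Finset.mem_image_of_mem _ (Finset.mem_range.2 hy),
      ZMod.val_cast_of_lt (hy.trans_le hm)⟩
  · rintro ⟨i, hi, rfl⟩
    obtain ⟨j, hj, rfl⟩ := Finset.mem_image.1 hi
    have hj := Finset.mem_range.1 hj
    rwa [ZMod.val_cast_of_lt (hj.trans_le hm)]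

/-- A normal form of `A` still has a mate and passes all the tests, so it occurs in the enumeration;
the search leaves it no choice but to be the interval factor. -/
theorem factorEquiv_intervalFactor_of_check (hm : 0 < m) (hc : check n m c = true)
    {A B : Finset (DihedralGroup n)} (h : IsNearFactorization (2 * m + 1) l A B) :
    FactorEquiv A (intervalFactor n m) := by
  obtain ⟨S, T, hA, hS, hT, hS', hT'⟩ := exists_factorEquiv_isNormal h hm rfl
  obtain ⟨B', h'⟩ := hA.exists_isNearFactorization h
  suffices hST : dihedralSet S T = intervalFactor n m by rwa [hST] at hA
  have hmn : m + 1 ≤ n := by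
    have := Finset.card_le_univ S
    rwa [ZMod.card, hS] at this
  have hlt : ∀ {S : Finset (ZMod n)} {L : List ℕ}, (L : Multiset ℕ) = (S.image ZMod.val).val →
      ∀ y ∈ L, y < n := by
    intro S L hL y hy
    obtain ⟨i, -, rfl⟩ := (mem_iff_of_coe_eq hL y).1 hy
    exact ZMod.val_lt i
  have hU : ∀ x, (packed (2 ^ 3) (4 * n) fun i => if i % (2 * n) = 0 then 0 else 1).testBit x =
      true ↔ ∃ i < 4 * n, i % (2 * n) ≠ 0 ∧ x = 3 * i := by
    intro x
    rw [testBit_packed three_pos fun i => by split_ifs <;> simp]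
    simp
  rw [check_eq, checkWith, force_eq] at hc
  obtain ⟨R₀, hc, hR₀⟩ := exists_of_collectSubsets_zmod hc
  obtain ⟨R₁, hc, hR₁⟩ := exists_of_collectSubsets_zmod hc
  obtain ⟨L₀, hL₀, hP₀⟩ := hR₀ S hS'.zero_mem hS
  obtain ⟨L₁, hL₁, hP₁⟩ := hR₁ T hT'.zero_mem (by rw [hT]; exact (Nat.sub_add_cancel hm).symm)
  have hp := fun hn : Even n => card_parity hn h'
  have hF₀ := hP₀ (by
    have h1 := parityTest_eq_true hL₀ fun hn => (hp hn).1
    rw [hS] at h1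
    rw [Nat.succ_eq_add_one, h1, isMin_eq_true hS' hL₀ fun a => exists_unit_of_mem_unitList]
    rfl)
  have hF₁ := hP₁ (by
    have h1 := parityTest_eq_true hL₁ fun hn => (hp hn).2
    rw [hT] at h1
    rw [h1, isMin_eq_true hT' hL₁ fun a ha => ⟨1, Subgroup.one_mem _, by
      rw [List.mem_singleton.1 ha]; simp⟩]
    rfl)
  have hno := allList_eq_true.1 (allList_eq_true.1 hc _ hF₀) _ hF₁
  have hl₀ : ∀ y ∈ List.range (Nat.succ m), 0 + y < 2 * n := fun y hy => by
    have := List.mem_range.1 hy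
    omega
  have hl₁ : ∀ y ∈ List.range m, n + y < 2 * n := fun y hy => by
    have := List.mem_range.1 hy
    omega
  rw [lookup_eq hl₀, lookup_eq hl₁, lookup_eq fun y hy => by have := hlt hL₀ y hy; omega,
    lookup_eq fun y hy => by have := hlt hL₁ y hy; omega] at hno
  have hW : 2 ^ (12 * n) < 2 ^ (12 * n + 1) := Nat.pow_lt_pow_right (by norm_num) (Nat.lt_succ_self _)
  have hlor := packed_lor (m := 2 * n)
    (fun b => (tiles_lt (n := n) 0 (List.range (Nat.succ m)) b).trans hW)
    (fun b => (tiles_lt (n := n) n (List.range m) b).trans hW)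
  change noMate _ _ _ _ _ _ (_ ||| _) _ _ = true at hno
  rw [hlor] at hno
  exact eq_of_noMate h' (Finset.card_pos.1 (by rw [h'.1]; omega))
    (isTiling_tiles (mem_range_iff_exists_val hmn)
      (mem_range_iff_exists_val (Nat.le_of_succ_le hmn)))
    (isTiling_tiles (mem_iff_of_coe_eq hL₀) (mem_iff_of_coe_eq hL₁))
    (tiles_lt _ _) (tiles_lt _ _) hU hno

end soundness

end NearFactorization

namespace NearFactorization

/-! ### Dihedral groups of order at most 64 -/

/-- In this and the next checks, `n = (2 * m + 1) * c + m + 1`, with `m ≤ c` and `n ≤ 32`. -/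
theorem check_one : ∀ c : Fin 10, check (3 * (c + 1) + 2) 1 (c + 1) = true := by decide +kernel

theorem check_two : ∀ c : Fin 4, check (5 * (c + 2) + 3) 2 (c + 2) = true := by decide +kernel

theorem check_three_three : check 25 3 3 = true := by decide +kernel

theorem check_three_four : check 32 3 4 = true := by decide +kernel

theorem check_eq_true {n m c : ℕ} (hn : n ≤ 32) (hm : 0 < m) (hmc : m ≤ c)
    (h : (2 * m + 1) * (2 * c + 1) = 2 * n - 1) : check n m c = true := by
  -- If `m ≥ 4`, both factors are at least `9`, but `81 > 63`.
  have hm3 : m ≤ 3 := by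
    by_contra hm3
    have : 9 * 9 ≤ (2 * m + 1) * (2 * c + 1) := Nat.mul_le_mul (by omega) (by omega)
    omega
  interval_cases m
  · obtain rfl : n = 3 * c + 2 := by omega
    obtain ⟨d, rfl⟩ := Nat.exists_eq_add_of_le' hmc
    exact check_one ⟨d, by omega⟩
  · obtain rfl : n = 5 * c + 3 := by omega
    obtain ⟨d, rfl⟩ := Nat.exists_eq_add_of_le' hmc
    exact check_two ⟨d, by omega⟩
  · obtain rfl | rfl : c = 3 ∨ c = 4 := by omega
    · obtain rfl : n = 25 := by omega
      exact check_three_three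
    · obtain rfl : n = 32 := by omega
      exact check_three_four

theorem exists_odd_odd {k l n : ℕ} (hn : 0 < n) (h : k * l = 2 * n - 1) :
    ∃ m c, k = 2 * m + 1 ∧ l = 2 * c + 1 := by
  have h1 : Odd (k * l) := ⟨n - 1, by omega⟩
  obtain ⟨⟨m, hm⟩, c, hc⟩ := Nat.odd_mul.1 h1
  exact ⟨m, c, hm, hc⟩

variable {n k l : ℕ} [NeZero n] {A B A' B' : Finset (DihedralGroup n)}

theorem nearFactorizationEquiv_of_le (hn : n ≤ 32) (h : IsNearFactorization k l A B)
    (h' : IsNearFactorization k l A' B') (hkl : k ≤ l) : NearFactorizationEquiv A B A' B' := by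
  have hc := h.2.2.1
  rw [h.1, h.2.1, DihedralGroup.card] at hc
  obtain ⟨m, c, rfl, rfl⟩ := exists_odd_odd (NeZero.pos n) hc
  refine nearFactorizationEquiv_of_factorEquiv h h' (Finset.card_pos.1 (by rw [h'.1]; omega)) ?_
  rcases Nat.eq_zero_or_pos m with rfl | hm
  -- Singletons differ by a right translation.
  · obtain ⟨x, rfl⟩ := Finset.card_eq_one.1 h.1
    obtain ⟨y, rfl⟩ := Finset.card_eq_one.1 h'.1
    exact ⟨1, x⁻¹ * y, by simp⟩
  · have hch := check_eq_true hn hm (by omega) hc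
    exact (factorEquiv_intervalFactor_of_check hm hch h).trans
      (factorEquiv_intervalFactor_of_check hm hch h').symm

theorem nearFactorizationEquiv_of_isNearFactorization (hn : n ≤ 32)
    (h : IsNearFactorization k l A B) (h' : IsNearFactorization k l A' B') :
    NearFactorizationEquiv A B A' B' := by
  rcases le_total k l with hkl | hkl
  · exact nearFactorizationEquiv_of_le hn h h' hkl
  · exact nearFactorizationEquiv_of_inv (nearFactorizationEquiv_of_le hn
      (isNearFactorization_inv h) (isNearFactorization_inv h') hkl)

end NearFactorization

theorem mainTheorem11 (n : ℕ) [NeZero n] (hn : n ≤ 32) (k : ℕ)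
    (hk : k ∈ (2 * n - 1).properDivisors) :
    ∃ A B : Finset (DihedralGroup n),
      IsNearFactorization k ((2 * n - 1) / k) A B ∧
      ∀ A' B' : Finset (DihedralGroup n),
        IsNearFactorization k ((2 * n - 1) / k) A' B' → NearFactorizationEquiv A B A' B' := by
  have hmul := Nat.mul_div_cancel' (Nat.mem_properDivisors.1 hk).1
  generalize (2 * n - 1) / k = l at hmul ⊢
  obtain ⟨m, c, rfl, rfl⟩ := NearFactorization.exists_odd_odd (NeZero.pos n) hmul
  have h := NearFactorization.isNearFactorization_intervalFactor hmul
  exact ⟨_, _, h, fun A' B' h' =>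
    NearFactorization.nearFactorizationEquiv_of_isNearFactorization hn h h'⟩
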